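/- Let $\Gamma$ be the set of edges between nearest neighbours of the square lattice $\mathbb{Z}^2$, with a spin-1/2 at each edge, and let $\mathfrak{A}$ be the quasi-local $C^*$-algebra, i.e. the norm completion of $\mathfrak{A}_{loc}=\bigcup_{\Lambda}\mathfrak{A}(\Lambda)$, where $\mathfrak{A}(\Lambda)=\bigotimes_{j\in\Lambda}M_2(\mathbb{C})$ for finite $\Lambda\subset\Gamma$. Let $\sigma_j^x,\sigma_j^y,\sigma_j^z$ be the Pauli matrices at the edge $j$. For a vertex $v$ let the star $s$ be the set of the four edges that begin or end in $v$, and for a face let the plaquette $p$ be the set of the four edges around it; put $A_s=\prod_{j\in s}\sigma_j^x$ and $B_p=\prod_{j\in p}\sigma_j^z$. The toric code interaction is $\Phi(\Lambda)=-A_s$ if $\Lambda$ is a star $s$, $\Phi(\Lambda)=-B_p$ if $\Lambda$ is a plaquette $p$, and $\Phi(\Lambda)=0$ for all other finite $\Lambda$; let $H_\Lambda=\sum_{X\subseteq\Lambda}\Phi(X)$. A state $\omega$ on $\mathfrak{A}$ is a ground state for a strongly continuous one-parameter group $\alpha$ of automorphisms of $\mathfrak{A}$ if $\omega\circ\alpha_t=\omega$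 for all $t\in\mathbb{R}$ and the self-adjoint operator $H_\omega$ in the GNS representation $(\pi_\omega,\mathcal{H}_\omega,\Omega)$ of $\omega$, given by $e^{itH_\omega}\pi_\omega(A)\Omega=\pi_\omega(\alpha_t(A))\Omega$, is positive. (1) There is a unique strongly continuous one-parameter group $t\mapsto\alpha_t$ of automorphisms of $\mathfrak{A}$ (the toric code dynamics) such that $\alpha_t(A)=\lim_{\Lambda\to\Gamma}e^{itH_\Lambda}Ae^{-itH_\Lambda}$ in norm for all $A\in\mathfrak{A}$ and $t\in\mathbb{R}$, and $\frac{d}{dt}\alpha_t(A)\big|_{t=0}=\lim_{\Lambda\to\Gamma}i[H_\Lambda,A]$ for all $A\in\mathfrak{A}_{loc}$. (2) Every state $\omega$ on $\mathfrak{A}$ with $\omega(A_s)=\omega(B_p)=1$ for all stars $s$ and plaquettes $p$ is a ground state for the toric code dynamics. (3) Let $\mathfrak{A}_{cl}\subset\mathfrak{A}$ be the $C^*$-algebra generated by all $A_s$ and $B_p$, and let $S=\{-1,1\}^{\{\text{stars}\}}$ and $T=\{-1,1\}^{\{\text{plaquettes}\}}$ be the configuration spaces (with the product topology) of two classical Ising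 systems. There is a $*$-isomorphism $\Theta:\mathfrak{A}_{cl}\to C(S\times T)$ that maps $A_s$ to the function $(f,g)\mapsto f(s)$ and $B_p$ to $(f,g)\mapsto g(p)$. The state $\omega_{cl}$ on $\mathfrak{A}_{cl}$ given by evaluating $\Theta(\cdot)$ at the configuration with all spins equal to $+1$ has a unique extension to a state on $\mathfrak{A}$. (4) There is exactly one state $\omega$ on $\mathfrak{A}$ with $\omega(A_s)=\omega(B_p)=1$ for all stars $s$ and plaquettes $p$. (5) This state is given on local Pauli monomials as follows: $\omega(A)=1$ if $A$ is a finite product of star and plaquette operators, and for a monomial $A=\prod_{j\in\Lambda}\sigma_j^{k_j}$ (with $\Lambda\subset\Gamma$ finite and $k_j\in\{x,y,z\}$) such that neither $A$ nor $-A$ is a finite product of star and plaquette operators, $\omega(A)=0$. -/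

import Mathlib

open scoped ComplexOrder

noncomputable section

namespace ToricCode

/-! ### The quasi-local algebra of a spin-1/2 system -/

section QuasiLocal

variable (Γ : Type*) [DecidableEq Γ]

/-- The Hilbert space with orthonormal basis the configurations of spins (in the `z`-basis) on
the set of sites `Γ` with only finitely many spins down. A configuration is encoded by the finite
set of the sites at which the spin is down. -/
abbrev SpinSpace : Type _ := lp (fun _ : Finset Γ => ℂ) 2

variable {Γ}

/-- The local spin at the site `j` in the configuration `s`: `0` for up, `1` for down. -/
def spinAt (j : Γ) (s : Finset Γ) : Fin 2 := if j ∈ s then 1 else 0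

/-- The configuration `s` with the spin at the site `j` flipped. -/
def flipAt (j : Γ) (s : Finset Γ) : Finset Γ := symmDiff s {j}

theorem flipAt_flipAt (j : Γ) (s : Finset Γ) : flipAt j (flipAt j s) = s := by
  simp [flipAt]

theorem flipAt_comm (i j : Γ) (s : Finset Γ) : flipAt i (flipAt j s) = flipAt j (flipAt i s) := by
  simp [flipAt, symmDiff_right_comm]

theorem spinAt_flipAt_self (j : Γ) (s : Finset Γ) : spinAt j (flipAt j s) = spinAt j s + 1 := by
  by_cases h : j ∈ s <;> simp [spinAt, flipAt, Finset.mem_symmDiff, h]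

theorem spinAt_flipAt_of_ne {i j : Γ} (h : i ≠ j) (s : Finset Γ) :
    spinAt i (flipAt j s) = spinAt i s := by
  simp [spinAt, flipAt, Finset.mem_symmDiff, h]

/-- The bounded operator `(T f)(s) = w(s) f(e(s))` on `ℓ²`, for a bounded function `w` and a
bijection `e`. -/
def weightedShift (w : Finset Γ → ℂ) (C : ℝ) (hw : ∀ s, ‖w s‖ ≤ C) (e : Equiv.Perm (Finset Γ)) :
    SpinSpace Γ →L[ℂ] SpinSpace Γ :=
  have hC : 0 ≤ C := (norm_nonneg _).trans (hw ∅)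
  have hsum : ∀ f : SpinSpace Γ, Summable fun s => ‖f (e s)‖ ^ (2 : ENNReal).toReal := fun f =>
    e.summable_iff.mpr ((lp.memℓp f).summable (by norm_num))
  have hle : ∀ (f : SpinSpace Γ) (s : Finset Γ), ‖w s * f (e s)‖ ^ (2 : ENNReal).toReal
      ≤ C ^ (2 : ENNReal).toReal * ‖f (e s)‖ ^ (2 : ENNReal).toReal := fun f s => by
    rw [norm_mul, Real.mul_rpow (norm_nonneg _) (norm_nonneg _)]
    gcongr
    exact hw s
  have hsum' : ∀ f : SpinSpace Γ, Summable fun s => ‖w s * f (e s)‖ ^ (2 : ENNReal).toReal :=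
    fun f => Summable.of_nonneg_of_le (fun s => by positivity) (hle f) ((hsum f).mul_left _)
  LinearMap.mkContinuous
    { toFun := fun f => ⟨fun s => w s * f (e s), memℓp_gen (hsum' f)⟩
      map_add' := fun f g => by
        ext s
        exact mul_add (w s) (f (e s)) (g (e s))
      map_smul' := fun c f => by
        ext s
        exact mul_left_comm (w s) c (f (e s)) } C fun f => by
    refine lp.norm_le_of_tsum_le (by norm_num) (by positivity) ?_
    rw [Real.mul_rpow hC (norm_nonneg _), lp.norm_rpow_eq_tsum (by norm_num) f,
      ← e.tsum_eq fun s => ‖f s‖ ^ (2 : ENNReal).toReal, ← tsum_mul_left]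
    exact (hsum' f).tsum_le_tsum (hle f) ((hsum f).mul_left _)

theorem inner_weightedShift (w w' : Finset Γ → ℂ) (C C' : ℝ) (hw : ∀ s, ‖w s‖ ≤ C)
    (hw' : ∀ s, ‖w' s‖ ≤ C') (e e' : Equiv.Perm (Finset Γ)) (he : ∀ s, e' (e s) = s)
    (h : ∀ s, w' (e s) = star (w s)) (f g : SpinSpace Γ) :
    inner ℂ (weightedShift w C hw e f) g = inner ℂ f (weightedShift w' C' hw' e' g) := by
  rw [lp.inner_eq_tsum, lp.inner_eq_tsum, ← e.tsum_eq fun s => inner ℂ (f s) _]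
  refine tsum_congr fun s => ?_
  change inner ℂ (w s * f (e s)) (g s) = inner ℂ (f (e s)) (w' (e s) * g (e' (e s)))
  rw [he, h]
  simp
  ring

/-- The spin flip at the site `j` as a permutation of the configurations. -/
def flipPerm (j : Γ) : Equiv.Perm (Finset Γ) :=
  ⟨flipAt j, flipAt j, flipAt_flipAt j, flipAt_flipAt j⟩

theorem norm_entry_le (M : Matrix (Fin 2) (Fin 2) ℂ) (a b : Fin 2) :
    ‖M a b‖ ≤ ∑ i, ∑ k, ‖M i k‖ :=
  (Finset.single_le_sum (f := fun k => ‖M a k‖) (fun _ _ => norm_nonneg _)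
    (Finset.mem_univ b)).trans
    (Finset.single_le_sum (f := fun i => ∑ k, ‖M i k‖)
      (fun _ _ => Finset.sum_nonneg fun _ _ => norm_nonneg _) (Finset.mem_univ a))

/-- A `2 × 2` matrix `M`, acting on the spin at the site `j` and trivially on all other spins:
`(M f)(s) = M (s_j) (s_j) f(s) + M (s_j) (s_j + 1) f(θ_j s)`, where `θ_j` flips the spin at `j`. -/
def siteOp (j : Γ) (M : Matrix (Fin 2) (Fin 2) ℂ) : SpinSpace Γ →L[ℂ] SpinSpace Γ :=
  weightedShift (fun s => M (spinAt j s) (spinAt j s)) _ (fun _ => norm_entry_le M _ _)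
      (Equiv.refl _)
    + weightedShift (fun s => M (spinAt j s) (spinAt j s + 1)) _ (fun _ => norm_entry_le M _ _)
      (flipPerm j)

theorem siteOp_apply (j : Γ) (M : Matrix (Fin 2) (Fin 2) ℂ) (f : SpinSpace Γ) (s : Finset Γ) :
    siteOp j M f s = M (spinAt j s) (spinAt j s) * f s
      + M (spinAt j s) (spinAt j s + 1) * f (flipAt j s) := rfl

theorem spinAt_eq (j : Γ) (s : Finset Γ) : spinAt j s = 0 ∨ spinAt j s = 1 := by
  unfold spinAt; split_ifs <;> simp

theorem siteOp_mul (j : Γ) (M N : Matrix (Fin 2) (Fin 2) ℂ) :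
    siteOp j (M * N) = siteOp j M * siteOp j N := by
  ext f s
  change siteOp j (M * N) f s = siteOp j M (siteOp j N f) s
  simp only [siteOp_apply, spinAt_flipAt_self, flipAt_flipAt]
  rcases spinAt_eq j s with h | h <;> simp [h, Matrix.mul_apply, Fin.sum_univ_two] <;> ring

theorem siteOp_commute {i j : Γ} (hij : i ≠ j) (M N : Matrix (Fin 2) (Fin 2) ℂ) :
    Commute (siteOp i M) (siteOp j N) := by
  ext f s
  change siteOp i M (siteOp j N f) s = siteOp j N (siteOp i M f) s
  simp only [siteOp_apply, spinAt_flipAt_of_ne hij, spinAt_flipAt_of_ne hij.symm,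
    flipAt_comm i j]
  ring

theorem siteOp_star (j : Γ) (M : Matrix (Fin 2) (Fin 2) ℂ) :
    siteOp j (star M) = star (siteOp j M) := by
  rw [ContinuousLinearMap.star_eq_adjoint, ContinuousLinearMap.eq_adjoint_iff]
  intro f g
  simp only [siteOp, add_apply, inner_add_left, inner_add_right]
  congr 1
  · exact inner_weightedShift _ _ _ _ _ _ _ _ (fun _ => rfl) (fun s => by simp) f g
  · refine inner_weightedShift _ _ _ _ _ _ _ _ (flipAt_flipAt j) (fun s => ?_) f g
    change M (spinAt j (flipAt j s)) (spinAt j (flipAt j s) + 1) = _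
    rw [spinAt_flipAt_self]
    rcases spinAt_eq j s with h | h <;> simp [h]

/-- The embedding of the one-site algebra `M₂(ℂ)` at the site `j`, as operators on `ℓ²`. -/
def siteHom (j : Γ) : Matrix (Fin 2) (Fin 2) ℂ →⋆ₐ[ℂ] (SpinSpace Γ →L[ℂ] SpinSpace Γ) :=
  have hone : siteOp j (1 : Matrix (Fin 2) (Fin 2) ℂ) = 1 := by
    ext f s
    change siteOp j 1 f s = f s
    rw [siteOp_apply]
    rcases spinAt_eq j s with h | h <;> simp [h]
  have hadd : ∀ M N, siteOp j (M + N) = siteOp j M + siteOp j N := fun M N => by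
    ext f s
    change siteOp j (M + N) f s = siteOp j M f s + siteOp j N f s
    simp only [siteOp_apply, Matrix.add_apply]
    ring
  have hsmul : ∀ (c : ℂ) (M), siteOp j (c • M) = c • siteOp j M := fun c M => by
    ext f s
    change siteOp j (c • M) f s = c * siteOp j M f s
    simp only [siteOp_apply, Matrix.smul_apply, smul_eq_mul]
    ring
  { toFun := siteOp j
    map_one' := hone
    map_mul' := siteOp_mul j
    map_zero' := by simpa using hsmul 0 0
    map_add' := hadd
    commutes' := fun c => by
      rw [Algebra.algebraMap_eq_smul_one, Algebra.algebraMap_eq_smul_one, hsmul, hone]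
    map_star' := siteOp_star j }

variable (Γ) in
/-- The norm closure of the `*`-algebra generated by the one-site algebras `M₂(ℂ)`. -/
def quasiLocalSubalgebra : StarSubalgebra ℂ (SpinSpace Γ →L[ℂ] SpinSpace Γ) :=
  (StarAlgebra.adjoin ℂ (⋃ j : Γ, Set.range (siteHom j))).topologicalClosure

variable (Γ) in
/-- The quasi-local algebra of a spin-1/2 system on the set of sites `Γ`: the completion of the
algebra of local observables `⋃ Λ, ⨂ j ∈ Λ, M₂(ℂ)`, realised on the Hilbert space `SpinSpace Γ`,
where it is the norm closure of the union of the local algebras. Operators at different sites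
commute, so that the one-site algebras at the sites of a finite set `Λ` generate a copy of the
simple algebra `⨂ j ∈ Λ, M₂(ℂ)`, with the operator norm as its unique C⋆-norm. -/
def QuasiLocal : Type _ := quasiLocalSubalgebra Γ

instance : CStarAlgebra (QuasiLocal Γ) :=
  haveI : IsClosed (quasiLocalSubalgebra Γ : Set (SpinSpace Γ →L[ℂ] SpinSpace Γ)) :=
    StarSubalgebra.isClosed_topologicalClosure _
  inferInstanceAs (CStarAlgebra (quasiLocalSubalgebra Γ))

/-- The usual order of a C⋆-algebra: `a ≤ b` if and only if `b - a` is positive. -/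
instance : PartialOrder (QuasiLocal Γ) := CStarAlgebra.spectralOrder _

instance : StarOrderedRing (QuasiLocal Γ) := CStarAlgebra.spectralOrderedRing _

theorem siteHom_mem (j : Γ) (M : Matrix (Fin 2) (Fin 2) ℂ) :
    siteHom j M ∈ quasiLocalSubalgebra Γ :=
  StarSubalgebra.le_topologicalClosure _
    (StarAlgebra.subset_adjoin ℂ _ (Set.mem_iUnion.mpr ⟨j, M, rfl⟩))

/-- The embedding `M₂(ℂ) = 𝔄({j}) → 𝔄` of the observables at the site `j`. -/
def spin (j : Γ) : Matrix (Fin 2) (Fin 2) ℂ →⋆ₐ[ℂ] QuasiLocal Γ :=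
  (siteHom j).codRestrict (quasiLocalSubalgebra Γ) (siteHom_mem j)

theorem spin_commute {i j : Γ} (hij : i ≠ j) (M N : Matrix (Fin 2) (Fin 2) ℂ) :
    Commute (spin i M) (spin j N) :=
  Subtype.ext (siteOp_commute hij M N)

/-- The algebra `𝔄(Λ)` of the observables that are localised in `Λ`. -/
def localAlgebra (Λ : Finset Γ) : StarSubalgebra ℂ (QuasiLocal Γ) :=
  StarAlgebra.adjoin ℂ (⋃ j ∈ Λ, Set.range (spin j))

/-! ### Pauli matrices and Pauli monomials -/

/-- The Pauli matrices `σ^x`, `σ^y`, `σ^z` (indexed by `0`, `1`, `2`). -/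
def pauli : Fin 3 → Matrix (Fin 2) (Fin 2) ℂ :=
  ![!![0, 1; 1, 0], !![0, -Complex.I; Complex.I, 0], !![1, 0; 0, -1]]

theorem pauli_star (k : Fin 3) : star (pauli k) = pauli k := by
  fin_cases k <;> ext a b <;> fin_cases a <;> fin_cases b <;> simp [pauli]

theorem pauli_pairwise (Λ : Finset Γ) (k : Γ → Fin 3) :
    (Λ : Set Γ).Pairwise (Function.onFun Commute fun j => spin j (pauli (k j))) :=
  fun _ _ _ _ h => spin_commute h _ _

/-- The Pauli monomial `∏ j ∈ Λ, σ_j^{k j}`. -/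
def pauliMonomial (Λ : Finset Γ) (k : Γ → Fin 3) : QuasiLocal Γ :=
  Λ.noncommProd (fun j => spin j (pauli (k j))) (pauli_pairwise Λ k)

theorem pauliMonomial_mem (Λ : Finset Γ) (k : Γ → Fin 3) :
    pauliMonomial Λ k ∈ localAlgebra Λ :=
  Finset.noncommProd_induction _ _ _ (· ∈ localAlgebra Λ) (fun _ _ => mul_mem) (one_mem _)
    fun _ hj => StarAlgebra.subset_adjoin ℂ _ (Set.mem_biUnion hj ⟨_, rfl⟩)

theorem pauliMonomial_isSelfAdjoint (Λ : Finset Γ) (k : Γ → Fin 3) :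
    IsSelfAdjoint (pauliMonomial Λ k) := by
  induction Λ using Finset.induction_on with
  | empty => simp [pauliMonomial]
  | insert j Λ hj ih =>
    have hs : IsSelfAdjoint (spin j (pauli (k j))) := by
      rw [IsSelfAdjoint, ← map_star, pauli_star]
    have hc : Commute (spin j (pauli (k j))) (pauliMonomial Λ k) :=
      Finset.noncommProd_commute _ _ _ _ fun i hi =>
        spin_commute (fun h : j = i => hj (h ▸ hi)) _ _
    rw [pauliMonomial, Finset.noncommProd_insert_of_notMem _ _ _ _ hj]
    exact (hs.commute_iff ih).mp hc

/-! ### States and ground states -/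

/-- A state: a positive linear functional that takes the value `1` at the identity. -/
def IsState {A : Type*} [CStarAlgebra A] [PartialOrder A] (ω : A →ₚ[ℂ] ℂ) : Prop := ω 1 = 1

section GroundState

/-- The infinitesimal generator `-i d/dt U(t)|_{t=0}` of a one-parameter group of unitaries, as an
operator on the space of all vectors at which the derivative exists: the operator `H` of Stone's
theorem, with `U(t) = exp(i t H)`. -/
def stoneGenerator {H : Type*} [NormedAddCommGroup H] [InnerProductSpace ℂ H]
    (U : ℝ → (H ≃ₗᵢ[ℂ] H)) : H →ₗ.[ℂ] H where
  domain :=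
    { carrier := {ψ | DifferentiableAt ℝ (fun t => U t ψ) 0}
      zero_mem' := by simp
      add_mem' := fun {ψ φ} hψ hφ => by
        simpa using DifferentiableAt.fun_add hψ hφ
      smul_mem' := fun c ψ hψ => by
        simpa using DifferentiableAt.fun_const_smul hψ c }
  toFun :=
    { toFun := fun ψ => -Complex.I • deriv (fun t => U t ψ) 0
      map_add' := fun ψ φ => by
        simp only [Submodule.coe_add, map_add]
        rw [deriv_fun_add ψ.2 φ.2, smul_add]
      map_smul' := fun c ψ => by
        simp only [Submodule.coe_smul, map_smul, RingHom.id_apply]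
        rw [deriv_fun_const_smul c ψ.2, smul_comm] }

variable {A : Type*} [CStarAlgebra A] [PartialOrder A] [StarOrderedRing A]

/-- The cyclic vector `Ω` of the GNS representation of `ω`. -/
def gnsVector (ω : A →ₚ[ℂ] ℂ) : ω.GNS := (ω.toPreGNS 1 : ω.PreGNS)

/-- `U` is the strongly continuous one-parameter group of unitaries that implements `α` in the
GNS representation of `ω` and leaves the cyclic vector invariant. -/
structure ImplementsInGNS (α : ℝ → (A ≃⋆ₐ[ℂ] A)) (ω : A →ₚ[ℂ] ℂ)
    (U : ℝ → (ω.GNS ≃ₗᵢ[ℂ] ω.GNS)) : Prop where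
  map_add : ∀ s t ψ, U (s + t) ψ = U s (U t ψ)
  continuous : ∀ ψ, Continuous fun t => U t ψ
  covariant : ∀ t a ψ, U t (ω.gnsStarAlgHom a ψ) = ω.gnsStarAlgHom (α t a) (U t ψ)
  vacuum : ∀ t, U t (gnsVector ω) = gnsVector ω

/-- `ω` is a ground state for the one-parameter group `α`: a state that is invariant under every
`α t`, and such that the Hamiltonian `H_ω` that implements `α` in the GNS representation is
positive. -/
def IsGroundState (α : ℝ → (A ≃⋆ₐ[ℂ] A)) (ω : A →ₚ[ℂ] ℂ) : Prop :=
  IsState ω ∧ (∀ t a, ω (α t a) = ω a) ∧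
    ∃ U : ℝ → (ω.GNS ≃ₗᵢ[ℂ] ω.GNS), ImplementsInGNS α ω U ∧
      ∀ ψ : (stoneGenerator U).domain, 0 ≤ inner ℂ (ψ : ω.GNS) (stoneGenerator U ψ)

end GroundState

/-! ### Interactions and dynamics -/

variable (Γ) in
/-- An interaction: a self-adjoint observable `Φ(Λ) ∈ 𝔄(Λ)` for every finite set `Λ` of sites. -/
structure Interaction where
  toFun : Finset Γ → QuasiLocal Γ
  mem_local : ∀ Λ, toFun Λ ∈ localAlgebra Λ
  isSelfAdjoint : ∀ Λ, IsSelfAdjoint (toFun Λ)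

namespace Interaction

/-- The local Hamiltonian `H_Λ = ∑ X ⊆ Λ, Φ(X)`. -/
def hamiltonian (Φ : Interaction Γ) (Λ : Finset Γ) : QuasiLocal Γ :=
  ∑ X ∈ Λ.powerset, Φ.toFun X

/-- The local derivation `δ_Λ(a) = i [H_Λ, a]`. -/
def localDerivation (Φ : Interaction Γ) (Λ : Finset Γ) (a : QuasiLocal Γ) : QuasiLocal Γ :=
  Complex.I • (Φ.hamiltonian Λ * a - a * Φ.hamiltonian Λ)

/-- The local dynamics `exp(i t H_Λ) a exp(-i t H_Λ)`. -/
def localDynamics (Φ : Interaction Γ) (Λ : Finset Γ) (t : ℝ) (a : QuasiLocal Γ) : QuasiLocal Γ :=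
  NormedSpace.exp ((Complex.I * t) • Φ.hamiltonian Λ) * a *
    NormedSpace.exp (-(Complex.I * t) • Φ.hamiltonian Λ)

open Filter Topology in
/-- `α` is the time evolution of the interaction `Φ`: the strongly continuous one-parameter group
of automorphisms of the quasi-local algebra that is the thermodynamic limit of the local dynamics,
and whose generator is, on local observables, the limit of `i [H_Λ, a]`. Limits are taken along
the finite sets of sites, directed by inclusion. -/
structure IsDynamics (Φ : Interaction Γ) (α : ℝ → (QuasiLocal Γ ≃⋆ₐ[ℂ] QuasiLocal Γ)) :
    Prop where
  map_add : ∀ s t a, α (s + t) a = α s (α t a)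
  continuous : ∀ a, Continuous fun t => α t a
  tendsto : ∀ t a, Tendsto (fun Λ => Φ.localDynamics Λ t a) atTop (𝓝 (α t a))
  generator : ∀ Λ₀, ∀ a ∈ localAlgebra Λ₀, ∃ d : QuasiLocal Γ,
    Tendsto (fun Λ => Φ.localDerivation Λ a) atTop (𝓝 d) ∧ HasDerivAt (fun t => α t a) d 0

end Interaction

end QuasiLocal

/-! ### The toric code on the plane -/

/-- The edges of the square lattice `ℤ²`: `(v, false)` is the edge from `v` to `v + (1, 0)`, and
`(v, true)` is the edge from `v` to `v + (0, 1)`. -/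
abbrev Edge : Type := (ℤ × ℤ) × Bool

/-- The algebra of quasi-local observables of the toric code. -/
abbrev ToricAlgebra : Type := QuasiLocal Edge

/-- The star at the vertex `v`: the four edges that begin or end in `v`. -/
def starAt (v : ℤ × ℤ) : Finset Edge :=
  {(v, false), (v, true), (v - (1, 0), false), (v - (0, 1), true)}

/-- The plaquette with lower left corner `p`: the four edges around this face of the lattice. -/
def plaquetteAt (p : ℤ × ℤ) : Finset Edge :=
  {(p, false), (p, true), (p + (0, 1), false), (p + (1, 0), true)}

/-- The star operator `A_v = ⨂ j ∈ star v, σ_j^x`. -/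
def starOp (v : ℤ × ℤ) : ToricAlgebra := pauliMonomial (starAt v) fun _ => 0

/-- The plaquette operator `B_p = ⨂ j ∈ plaquette p, σ_j^z`. -/
def plaquetteOp (p : ℤ × ℤ) : ToricAlgebra := pauliMonomial (plaquetteAt p) fun _ => 2

open Classical in
/-- The toric code interaction: `-A_v` on the star of `v`, `-B_p` on the plaquette of `p`, and `0`
on all other finite sets of edges. -/
def toricInteraction : Interaction Edge where
  toFun Λ :=
    if ∃ v, Λ = starAt v then -pauliMonomial Λ fun _ => 0
    else if ∃ p, Λ = plaquetteAt p then -pauliMonomial Λ fun _ => 2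
    else 0
  mem_local Λ := by
    split_ifs
    · exact neg_mem (pauliMonomial_mem Λ _)
    · exact neg_mem (pauliMonomial_mem Λ _)
    · exact zero_mem _
  isSelfAdjoint Λ := by
    split_ifs
    · exact (pauliMonomial_isSelfAdjoint Λ _).neg
    · exact (pauliMonomial_isSelfAdjoint Λ _).neg
    · exact IsSelfAdjoint.zero _

/-- `ω(A_s) = ω(B_p) = 1` for all stars `s` and plaquettes `p`. -/
def IsStabilized (ω : ToricAlgebra →ₚ[ℂ] ℂ) : Prop :=
  (∀ v, ω (starOp v) = 1) ∧ ∀ p, ω (plaquetteOp p) = 1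

/-- The multiplicative monoid of all finite products of star and plaquette operators. -/
def stabilizerProducts : Submonoid ToricAlgebra :=
  Submonoid.closure (Set.range starOp ∪ Set.range plaquetteOp)

/-! ### The classical Ising picture -/

/-- The C⋆-algebra `𝔄_cl` that is generated by the star and plaquette operators. -/
def classicalAlgebra : StarSubalgebra ℂ ToricAlgebra :=
  (StarAlgebra.adjoin ℂ (Set.range starOp ∪ Set.range plaquetteOp)).topologicalClosure

theorem starOp_mem (v : ℤ × ℤ) : starOp v ∈ classicalAlgebra :=
  StarSubalgebra.le_topologicalClosure _ (StarAlgebra.subset_adjoin ℂ _ (Or.inl ⟨v, rfl⟩))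

theorem plaquetteOp_mem (p : ℤ × ℤ) : plaquetteOp p ∈ classicalAlgebra :=
  StarSubalgebra.le_topologicalClosure _ (StarAlgebra.subset_adjoin ℂ _ (Or.inr ⟨p, rfl⟩))

/-- The configurations of two copies of the classical Ising model: a spin `±1` for every star and
a spin `±1` for every plaquette. -/
abbrev IsingConfig : Type := (ℤ × ℤ → ℤˣ) × (ℤ × ℤ → ℤˣ)

/-- The value of the classical spin at the star of the vertex `v`. -/
def isingStar (v : ℤ × ℤ) : C(IsingConfig, ℂ) where
  toFun c := ((c.1 v : ℤ) : ℂ)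
  continuous_toFun := by
    have h : Continuous fun u : ℤˣ => ((u : ℤ) : ℂ) := continuous_of_discreteTopology
    exact h.comp (by fun_prop : Continuous fun c : IsingConfig => c.1 v)

/-- The value of the classical spin at the plaquette `p`. -/
def isingPlaquette (p : ℤ × ℤ) : C(IsingConfig, ℂ) where
  toFun c := ((c.2 p : ℤ) : ℂ)
  continuous_toFun := by
    have h : Continuous fun u : ℤˣ => ((u : ℤ) : ℂ) := continuous_of_discreteTopology
    exact h.comp (by fun_prop : Continuous fun c : IsingConfig => c.2 p)

/-- The configuration in which all classical spins are up. -/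
def allUp : IsingConfig := (fun _ => 1, fun _ => 1)

end ToricCode

end

/-! Everything is computed with the Pauli words `word X Z`, the product of the `σ^z` in `Z` times
the product of the `σ^x` in `X`. Up to the signs `sgn` they multiply like vectors over the field
with two elements, any two of them commute or anticommute, and their span is dense
(`dense_wordSpan`). Stars and plaquettes are commuting self-adjoint words of square 1.

Dynamics: the interaction terms commute with each other, and all terms outside a finite set commute
with a given word. These cancel from `exp(itH) a exp(-itH)`, so the local dynamics of a word is
eventually constant (`isLocalizing_toricInteraction`). Since all the evolutions are isometric, the
limit extends from the dense span to the whole algebra.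

Ground states: if `ω b = 1` for a self-adjoint `b` with `b * b = 1`, then `b` fixes the GNS vector
(`gnsMap_mul_eq`). Hence a word applied to this vector is an eigenvector of the dynamics whose
energy is 2 for each term of the interaction it anticommutes with
(`exists_gnsMap_toricDynamics_word`). Such vectors span a dense subspace, so the Hamiltonian is
diagonal with eigenvalues in `ℕ` and therefore positive (`inner_stoneGenerator_nonneg`).

Uniqueness and values: a word that anticommutes with some star or plaquette has expectation 0. A
word that commutes with all of them is a product of stars and plaquettes, because the plane has no
compactly supported first cohomology mod 2 (`exists_potential`), so its expectation is 1. This fixes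
the state on a dense subspace.

Existence and the Ising picture: string operators flip finitely many stars and plaquettes at will,
and a limit of vector states realises every sign configuration (`exists_state`). Values `±1` put the
generators into the multiplicative domain, so each such state restricts to a character of the
classical algebra. The character space is thus the whole configuration space, Gelfand duality gives
the isomorphism, and the extensions of the all-up character are exactly the stabilized states
(`isStabilized_iff`). -/

noncomputable section

namespace ToricCode

/-! ### Pauli words: signs, multiplication and density of their span. -/

section Words

variable {Γ : Type*} [DecidableEq Γ]

/-- The sign `(-1)^|A ∩ B|`. -/
def sgn (A B : Finset Γ) : ℂ := (-1) ^ (A ∩ B).card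

theorem sgn_comm (A B : Finset Γ) : sgn A B = sgn B A := by
  rw [sgn, sgn, Finset.inter_comm]

@[simp] theorem sgn_empty_left (B : Finset Γ) : sgn ∅ B = 1 := by simp [sgn]

@[simp] theorem sgn_empty_right (B : Finset Γ) : sgn B ∅ = 1 := by simp [sgn]

theorem sgn_eq_or (A B : Finset Γ) : sgn A B = 1 ∨ sgn A B = -1 := neg_one_pow_eq_or ℂ _

@[simp] theorem sgn_mul_self (A B : Finset Γ) : sgn A B * sgn A B = 1 := by
  rcases sgn_eq_or A B with h | h <;> simp [h]

@[simp] theorem norm_sgn (A B : Finset Γ) : ‖sgn A B‖ = 1 := by simp [sgn]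

@[simp] theorem star_sgn (A B : Finset Γ) : star (sgn A B) = sgn A B := by
  rcases sgn_eq_or A B with h | h <;> simp [h]

theorem sgn_ne_zero (A B : Finset Γ) : sgn A B ≠ 0 := by
  rcases sgn_eq_or A B with h | h <;> simp [h]

theorem sgn_singleton_left (j : Γ) (B : Finset Γ) : sgn {j} B = if j ∈ B then -1 else 1 := by
  by_cases h : j ∈ B <;> simp [sgn, h]

theorem sgn_of_disjoint {A B : Finset Γ} (h : Disjoint A B) : sgn A B = 1 := by
  simp [sgn, Finset.disjoint_iff_inter_eq_empty.mp h]

/-- Points of `A ∩ B ∩ C` are counted twice on the right and not at all on the left, which does not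
change parity. So `sgn` is a bilinear pairing on finite sets, viewed as vectors over the field with
two elements. -/
theorem sgn_symmDiff_left (A B C : Finset Γ) : sgn (symmDiff A B) C = sgn A C * sgn B C := by
  have h : (symmDiff A B ∩ C).card + 2 * ((A ∩ C) ∩ (B ∩ C)).card
      = (A ∩ C).card + (B ∩ C).card := by
    have h1 : symmDiff A B ∩ C = ((A ∩ C) \ (B ∩ C)) ∪ ((B ∩ C) \ (A ∩ C)) := by
      ext x
      simp only [Finset.mem_inter, Finset.mem_symmDiff, Finset.mem_union, Finset.mem_sdiff]
      tauto
    rw [h1, Finset.card_union_of_disjoint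
      (Finset.disjoint_left.mpr fun x hx hy => by
        simp only [Finset.mem_sdiff] at hx hy; exact hy.2 hx.1)]
    have h2 := Finset.card_sdiff_add_card_inter (A ∩ C) (B ∩ C)
    have h3 := Finset.card_sdiff_add_card_inter (B ∩ C) (A ∩ C)
    rw [Finset.inter_comm (B ∩ C) (A ∩ C)] at h3
    omega
  rw [sgn, sgn, sgn, ← pow_add, ← h, pow_add, pow_mul]
  simp

theorem sgn_symmDiff_right (A B C : Finset Γ) : sgn A (symmDiff B C) = sgn A B * sgn A C := by
  rw [sgn_comm, sgn_symmDiff_left, sgn_comm B, sgn_comm C]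

theorem symmDiff_singleton {j : Γ} {A : Finset Γ} (h : j ∉ A) : symmDiff {j} A = insert j A := by
  ext x
  simp only [Finset.mem_symmDiff, Finset.mem_singleton, Finset.mem_insert]
  by_cases hx : x = j
  · simp [hx, h]
  · simp [hx]

theorem sgn_insert {j : Γ} {A : Finset Γ} (h : j ∉ A) (B : Finset Γ) :
    sgn (insert j A) B = (if j ∈ B then -1 else 1) * sgn A B := by
  rw [← symmDiff_singleton h, sgn_symmDiff_left, sgn_singleton_left]

/-- The symmetric difference with `X` as a permutation of the configurations. -/
def symmDiffPerm (X : Finset Γ) : Equiv.Perm (Finset Γ) :=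
  ⟨fun s => symmDiff s X, fun s => symmDiff s X, fun s => by simp, fun s => by simp⟩

/-- The operator that flips the spins in `X` and then multiplies with the product of the `σ^z`
in `Z`. -/
def wordOp (X Z : Finset Γ) : SpinSpace Γ →L[ℂ] SpinSpace Γ :=
  weightedShift (fun s => sgn Z s) 1 (fun s => (norm_sgn Z s).le) (symmDiffPerm X)

theorem wordOp_apply (X Z : Finset Γ) (f : SpinSpace Γ) (s : Finset Γ) :
    wordOp X Z f s = sgn Z s * f (symmDiff s X) := rfl

/-- The sign arises from moving the flips in `X` past the `σ^z` in `Z'`. -/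
theorem wordOp_mul (X Z X' Z' : Finset Γ) :
    wordOp X Z * wordOp X' Z' = sgn X Z' • wordOp (symmDiff X X') (symmDiff Z Z') := by
  ext f s
  change wordOp X Z (wordOp X' Z' f) s = sgn X Z' * wordOp (symmDiff X X') (symmDiff Z Z') f s
  simp only [wordOp_apply, sgn_symmDiff_left, sgn_symmDiff_right, symmDiff_assoc, sgn_comm Z' X]
  ring

theorem wordOp_empty : wordOp (∅ : Finset Γ) ∅ = 1 := by
  ext f s
  change wordOp ∅ ∅ f s = f s
  rw [wordOp_apply, sgn_empty_left, one_mul, ← Finset.bot_eq_empty, symmDiff_bot]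

theorem wordOp_star (X Z : Finset Γ) : star (wordOp X Z) = sgn X Z • wordOp X Z := by
  symm
  rw [ContinuousLinearMap.star_eq_adjoint, ContinuousLinearMap.eq_adjoint_iff]
  intro f g
  change inner ℂ (sgn X Z • wordOp X Z f) g = _
  rw [inner_smul_left]
  have h : inner ℂ (wordOp X Z f) g = inner ℂ f (weightedShift (fun s => sgn X Z * sgn Z s) 1
      (fun s => by simp) (symmDiffPerm X) g) := by
    refine inner_weightedShift _ _ _ _ _ _ _ _ (fun s => by simp [symmDiffPerm]) (fun s => ?_) f g
    change sgn X Z * sgn Z (symmDiff s X) = _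
    rw [sgn_symmDiff_right, star_sgn, sgn_comm Z X, mul_left_comm, sgn_mul_self, mul_one]
  have h' : weightedShift (fun s => sgn X Z * sgn Z s) 1 (fun s => by simp) (symmDiffPerm X) g
      = sgn X Z • wordOp X Z g := by
    ext s
    exact mul_assoc _ _ _
  rw [h, h', inner_smul_right, ← Complex.star_def, star_sgn, ← mul_assoc, sgn_mul_self, one_mul]

/-- Expansion of a matrix in the basis `1`, `σ^z`, `σ^x`, `σ^z σ^x = i σ^y` of `M₂(ℂ)`. -/
theorem siteHom_eq (j : Γ) (M : Matrix (Fin 2) (Fin 2) ℂ) :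
    siteHom j M = ((M 0 0 + M 1 1) / 2) • wordOp ∅ ∅ + ((M 0 0 - M 1 1) / 2) • wordOp ∅ {j}
      + ((M 0 1 + M 1 0) / 2) • wordOp {j} ∅ + ((M 0 1 - M 1 0) / 2) • wordOp {j} {j} := by
  ext f s
  change siteOp j M f s = ((M 0 0 + M 1 1) / 2) * wordOp ∅ ∅ f s
    + ((M 0 0 - M 1 1) / 2) * wordOp ∅ {j} f s
      + ((M 0 1 + M 1 0) / 2) * wordOp {j} ∅ f s + ((M 0 1 - M 1 0) / 2) * wordOp {j} {j} f s
  have h0 : symmDiff s ∅ = s := by simp [← Finset.bot_eq_empty]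
  simp only [wordOp_apply, siteOp_apply, flipAt, h0, sgn_singleton_left, sgn_empty_left]
  by_cases h : j ∈ s <;> simp [spinAt, h] <;> ring

theorem wordOp_mem (X Z : Finset Γ) : wordOp X Z ∈ quasiLocalSubalgebra Γ := by
  have hx (j : Γ) : wordOp {j} ∅ ∈ quasiLocalSubalgebra Γ := by
    have := siteHom_eq j !![0, 1; 1, 0]
    norm_num at this
    exact this ▸ siteHom_mem j _
  have hz (j : Γ) : wordOp ∅ {j} ∈ quasiLocalSubalgebra Γ := by
    have := siteHom_eq j !![1, 0; 0, -1]
    norm_num at this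
    exact this ▸ siteHom_mem j _
  have hX : wordOp X ∅ ∈ quasiLocalSubalgebra Γ := by
    induction X using Finset.induction_on with
    | empty => rw [wordOp_empty]; exact one_mem _
    | insert j X hj ih =>
      have := wordOp_mul {j} ∅ X ∅
      rw [symmDiff_singleton hj, sgn_empty_right, one_smul, symmDiff_self] at this
      exact this ▸ mul_mem (hx j) ih
  have hZ : wordOp ∅ Z ∈ quasiLocalSubalgebra Γ := by
    induction Z using Finset.induction_on with
    | empty => rw [wordOp_empty]; exact one_mem _
    | insert j Z hj ih =>
      have := wordOp_mul ∅ {j} ∅ Z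
      rw [symmDiff_singleton hj, sgn_empty_left, one_smul, symmDiff_self] at this
      exact this ▸ mul_mem (hz j) ih
  have := wordOp_mul ∅ Z X ∅
  rw [sgn_empty_left, one_smul] at this
  simp only [← Finset.bot_eq_empty, symmDiff_bot, bot_symmDiff] at this
  exact this ▸ mul_mem hZ hX

/-- The product of the `σ^z` in `Z` and the `σ^x` in `X`. -/
def word (X Z : Finset Γ) : QuasiLocal Γ :=
  (⟨wordOp X Z, wordOp_mem X Z⟩ : quasiLocalSubalgebra Γ)

theorem word_mul (X Z X' Z' : Finset Γ) :
    word X Z * word X' Z' = sgn X Z' • word (symmDiff X X') (symmDiff Z Z') :=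
  Subtype.ext (wordOp_mul X Z X' Z')

theorem word_empty : word (∅ : Finset Γ) ∅ = 1 := Subtype.ext wordOp_empty

theorem word_star (X Z : Finset Γ) : star (word X Z) = sgn X Z • word X Z :=
  Subtype.ext (wordOp_star X Z)

theorem word_commute_sgn (X Z X' Z' : Finset Γ) :
    word X Z * word X' Z' = (sgn X Z' * sgn Z X') • (word X' Z' * word X Z) := by
  rw [word_mul, word_mul, smul_smul, symmDiff_comm X, symmDiff_comm Z, sgn_comm Z X', mul_assoc,
    sgn_mul_self, mul_one]

theorem word_mul_self (X Z : Finset Γ) : word X Z * word X Z = sgn X Z • 1 := by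
  rw [word_mul, symmDiff_self, symmDiff_self, ← word_empty]; rfl

theorem spin_eq (j : Γ) (M : Matrix (Fin 2) (Fin 2) ℂ) :
    spin j M = ((M 0 0 + M 1 1) / 2) • word ∅ ∅ + ((M 0 0 - M 1 1) / 2) • word ∅ {j}
      + ((M 0 1 + M 1 0) / 2) • word {j} ∅ + ((M 0 1 - M 1 0) / 2) • word {j} {j} :=
  Subtype.ext (siteHom_eq j M)

theorem pauliMonomial_empty (k : Γ → Fin 3) : pauliMonomial ∅ k = 1 :=
  Finset.noncommProd_empty _ _

theorem pauliMonomial_insert {j : Γ} {Λ : Finset Γ} (hj : j ∉ Λ) (k : Γ → Fin 3) :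
    pauliMonomial (insert j Λ) k = spin j (pauli (k j)) * pauliMonomial Λ k :=
  Finset.noncommProd_insert_of_notMem _ _ _ _ hj

theorem pauliMonomial_x (X : Finset Γ) : pauliMonomial X (fun _ => 0) = word X ∅ := by
  induction X using Finset.induction_on with
  | empty => rw [pauliMonomial_empty, word_empty]
  | insert j X hj ih =>
    rw [pauliMonomial_insert hj, ih, spin_eq]
    simp [pauli, word_mul, symmDiff_singleton hj]

theorem pauliMonomial_z (Z : Finset Γ) : pauliMonomial Z (fun _ => 2) = word ∅ Z := by
  induction Z using Finset.induction_on with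
  | empty => rw [pauliMonomial_empty, word_empty]
  | insert j Z hj ih =>
    rw [pauliMonomial_insert hj, ih, spin_eq]
    simp [pauli, word_mul, symmDiff_singleton hj]

theorem exists_spin_pauli_eq (j : Γ) (k : Fin 3) :
    ∃ (c : ℂ) (X Z : Finset Γ), ‖c‖ = 1 ∧ spin j (pauli k) = c • word X Z := by
  fin_cases k
  · exact ⟨1, {j}, ∅, by simp, by simp [spin_eq, pauli]⟩
  · exact ⟨-Complex.I, {j}, {j}, by simp, by simp [spin_eq, pauli, -neg_smul]; ring_nf⟩
  · exact ⟨1, ∅, {j}, by simp, by simp [spin_eq, pauli]⟩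

/-- Each factor `σ^y` contributes `-i`, and reordering contributes signs. Only `‖c‖ = 1` is
recorded; self-adjointness later forces `c = ±1` where it matters. -/
theorem exists_pauliMonomial_eq (Λ : Finset Γ) (k : Γ → Fin 3) :
    ∃ (c : ℂ) (X Z : Finset Γ), ‖c‖ = 1 ∧ pauliMonomial Λ k = c • word X Z := by
  induction Λ using Finset.induction_on with
  | empty => exact ⟨1, ∅, ∅, by simp, by simp [pauliMonomial_empty, word_empty]⟩
  | insert j Λ hj ih =>
    obtain ⟨c, X, Z, hc, h⟩ := ih
    obtain ⟨c', X', Z', hc', h'⟩ := exists_spin_pauli_eq j (k j)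
    exact ⟨c' * c * sgn X' Z, _, _, by simp [hc, hc'], by
      rw [pauliMonomial_insert hj, h, h', smul_mul_smul_comm, word_mul, smul_smul]⟩

variable (Γ) in
/-- The linear span of the products of Pauli matrices. -/
def wordSpan : Submodule ℂ (QuasiLocal Γ) :=
  Submodule.span ℂ (Set.range fun p : Finset Γ × Finset Γ => word p.1 p.2)

theorem word_mem_wordSpan (X Z : Finset Γ) : word X Z ∈ wordSpan Γ :=
  Submodule.subset_span ⟨(X, Z), rfl⟩

theorem wordSpan_induction {p : QuasiLocal Γ → Prop} (h : ∀ X Z, p (word X Z)) (h0 : p 0)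
    (hadd : ∀ a b, p a → p b → p (a + b)) (hsmul : ∀ (c : ℂ) a, p a → p (c • a))
    {a : QuasiLocal Γ} (ha : a ∈ wordSpan Γ) : p a := by
  induction ha using Submodule.span_induction with
  | mem x hx => obtain ⟨q, rfl⟩ := hx; exact h _ _
  | zero => exact h0
  | add x y _ _ hx hy => exact hadd x y hx hy
  | smul c x _ hx => exact hsmul c x hx

theorem mul_mem_wordSpan {a b : QuasiLocal Γ} (ha : a ∈ wordSpan Γ) (hb : b ∈ wordSpan Γ) :
    a * b ∈ wordSpan Γ := by
  refine wordSpan_induction (p := fun a => a * b ∈ wordSpan Γ) (fun X Z => ?_) ?_ ?_ ?_ ha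
  · refine wordSpan_induction (p := fun b => word X Z * b ∈ wordSpan Γ) (fun X' Z' => ?_)
      ?_ ?_ ?_ hb
    · rw [word_mul]
      exact Submodule.smul_mem _ _ (word_mem_wordSpan _ _)
    · simp
    · intro a b ha hb
      rw [mul_add]
      exact add_mem ha hb
    · intro c a ha
      rw [mul_smul_comm]
      exact Submodule.smul_mem _ _ ha
  · simp
  · intro a b ha hb
    rw [add_mul]
    exact add_mem ha hb
  · intro c a ha
    rw [smul_mul_assoc]
    exact Submodule.smul_mem _ _ ha

theorem star_mem_wordSpan {a : QuasiLocal Γ} (ha : a ∈ wordSpan Γ) : star a ∈ wordSpan Γ := by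
  refine wordSpan_induction (p := fun a => star a ∈ wordSpan Γ) (fun X Z => ?_) ?_ ?_ ?_ ha
  · rw [word_star]
    exact Submodule.smul_mem _ _ (word_mem_wordSpan _ _)
  · simp
  · intro a b ha hb
    rw [star_add]
    exact add_mem ha hb
  · intro c a ha
    rw [star_smul]
    exact Submodule.smul_mem _ _ ha

variable (Γ) in
/-- The linear span of the products of Pauli matrices, as a `*`-subalgebra. -/
def wordAlgebra : StarSubalgebra ℂ (QuasiLocal Γ) where
  carrier := wordSpan Γ
  mul_mem' := mul_mem_wordSpan
  one_mem' := word_empty (Γ := Γ) ▸ word_mem_wordSpan _ _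
  add_mem' := add_mem
  zero_mem' := zero_mem _
  algebraMap_mem' c := by
    rw [Algebra.algebraMap_eq_smul_one, ← word_empty]
    exact Submodule.smul_mem _ _ (word_mem_wordSpan _ _)
  star_mem' := star_mem_wordSpan

theorem spin_mem_wordSpan (j : Γ) (M : Matrix (Fin 2) (Fin 2) ℂ) : spin j M ∈ wordSpan Γ := by
  rw [spin_eq]
  exact add_mem (add_mem (add_mem (Submodule.smul_mem _ _ (word_mem_wordSpan _ _))
    (Submodule.smul_mem _ _ (word_mem_wordSpan _ _)))
    (Submodule.smul_mem _ _ (word_mem_wordSpan _ _)))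
    (Submodule.smul_mem _ _ (word_mem_wordSpan _ _))

theorem localAlgebra_le_wordAlgebra (Λ : Finset Γ) : localAlgebra Λ ≤ wordAlgebra Γ := by
  refine StarAlgebra.adjoin_le fun a ha => ?_
  simp only [Set.mem_iUnion, Set.mem_range] at ha
  obtain ⟨j, _, M, rfl⟩ := ha
  exact spin_mem_wordSpan j M

/-- The inclusion of the quasi-local algebra into the bounded operators. -/
def toOp : QuasiLocal Γ →⋆ₐ[ℂ] (SpinSpace Γ →L[ℂ] SpinSpace Γ) := (quasiLocalSubalgebra Γ).subtype

/-- The span of the words is already a `*`-algebra and contains all one-site algebras, so it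
contains the algebra whose closure defines `QuasiLocal Γ`. -/
theorem dense_wordSpan : Dense (wordSpan Γ : Set (QuasiLocal Γ)) := by
  have h : StarAlgebra.adjoin ℂ (⋃ j : Γ, Set.range (siteHom j)) ≤ (wordAlgebra Γ).map toOp := by
    refine StarAlgebra.adjoin_le fun a ha => ?_
    simp only [Set.mem_iUnion, Set.mem_range] at ha
    obtain ⟨j, M, rfl⟩ := ha
    exact ⟨spin j M, spin_mem_wordSpan j M, rfl⟩
  refine Subtype.dense_iff.mpr fun a ha => ?_
  exact closure_mono (fun x hx => h hx) ha

end Words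

/-! ### Stars, plaquettes and the homology of the square lattice -/

theorem starOp_eq (v : ℤ × ℤ) : starOp v = word (starAt v) ∅ := pauliMonomial_x _

theorem plaquetteOp_eq (p : ℤ × ℤ) : plaquetteOp p = word ∅ (plaquetteAt p) := pauliMonomial_z _

theorem mem_starAt_false (u v : ℤ × ℤ) : (u, false) ∈ starAt v ↔ u = v ∨ u + (1, 0) = v := by
  simp [starAt, eq_sub_iff_add_eq]

theorem mem_starAt_true (u v : ℤ × ℤ) : (u, true) ∈ starAt v ↔ u = v ∨ u + (0, 1) = v := by
  simp [starAt, eq_sub_iff_add_eq]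

theorem mem_plaquetteAt_false (u p : ℤ × ℤ) :
    (u, false) ∈ plaquetteAt p ↔ u = p ∨ u - (0, 1) = p := by
  simp [plaquetteAt, sub_eq_iff_eq_add]

theorem mem_plaquetteAt_true (u p : ℤ × ℤ) :
    (u, true) ∈ plaquetteAt p ↔ u = p ∨ u - (1, 0) = p := by
  simp [plaquetteAt, sub_eq_iff_eq_add]

theorem sgn_starAt (v : ℤ × ℤ) (B : Finset Edge) : sgn (starAt v) B =
    sgn {(v, false)} B * sgn {(v, true)} B * sgn {(v - (1, 0), false)} B
      * sgn {(v - (0, 1), true)} B := by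
  rw [starAt, sgn_insert (by simp [Prod.ext_iff]; omega),
    sgn_insert (by simp [Prod.ext_iff]; omega), sgn_insert (by simp)]
  simp only [sgn_singleton_left]
  ring

theorem sgn_plaquetteAt (p : ℤ × ℤ) (B : Finset Edge) : sgn (plaquetteAt p) B =
    sgn {(p, false)} B * sgn {(p, true)} B * sgn {(p + (0, 1), false)} B
      * sgn {(p + (1, 0), true)} B := by
  rw [plaquetteAt, sgn_insert (by simp), sgn_insert (by simp), sgn_insert (by simp)]
  simp only [sgn_singleton_left]
  ring

/-- An edge lies exactly in the stars of its two endpoints. As a function of the edge, membership in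
a star is therefore the coboundary of the indicator of its vertex, the form in which
`exists_potential` delivers its result. -/
theorem sgn_singleton_starAt_false (u v : ℤ × ℤ) :
    sgn {(u, false)} (starAt v) = sgn {u} {v} * sgn {u + (1, 0)} {v} := by
  simp only [sgn_singleton_left, mem_starAt_false, Finset.mem_singleton]
  by_cases h : u = v
  · simp [h]
  · by_cases h' : u + (1, 0) = v <;> simp [h, h']

theorem sgn_singleton_starAt_true (u v : ℤ × ℤ) :
    sgn {(u, true)} (starAt v) = sgn {u} {v} * sgn {u + (0, 1)} {v} := by
  simp only [sgn_singleton_left, mem_starAt_true, Finset.mem_singleton]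
  by_cases h : u = v
  · simp [h]
  · by_cases h' : u + (0, 1) = v <;> simp [h, h']

/-- The dual statement: an edge borders exactly two faces. -/
theorem sgn_singleton_plaquetteAt_false (u p : ℤ × ℤ) :
    sgn {(u, false)} (plaquetteAt p) = sgn {u} {p} * sgn {u - (0, 1)} {p} := by
  simp only [sgn_singleton_left, mem_plaquetteAt_false, Finset.mem_singleton]
  by_cases h : u = p
  · simp [h]
  · by_cases h' : u - (0, 1) = p <;> simp [h, h']

theorem sgn_singleton_plaquetteAt_true (u p : ℤ × ℤ) :
    sgn {(u, true)} (plaquetteAt p) = sgn {u} {p} * sgn {u - (1, 0)} {p} := by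
  simp only [sgn_singleton_left, mem_plaquetteAt_true, Finset.mem_singleton]
  by_cases h : u = p
  · simp [h]
  · by_cases h' : u - (1, 0) = p <;> simp [h, h']

/-- Each of the four faces at `v` borders two of the four edges of the star. After expansion every
factor occurs twice, and the combination cancels the four squares. -/
theorem sgn_starAt_plaquetteAt (v p : ℤ × ℤ) : sgn (starAt v) (plaquetteAt p) = 1 := by
  rw [sgn_starAt, sgn_singleton_plaquetteAt_false, sgn_singleton_plaquetteAt_true,
    sgn_singleton_plaquetteAt_false, sgn_singleton_plaquetteAt_true,
    sub_right_comm v (0, 1) (1, 0)]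
  linear_combination (sgn {v} {p} * sgn {v} {p} * sgn {v - (0, 1)} {p} * sgn {v - (0, 1)} {p}
      * sgn {v - (1, 0)} {p} * sgn {v - (1, 0)} {p}) * sgn_mul_self {v - (1, 0) - (0, 1)} {p}
    + (sgn {v} {p} * sgn {v} {p} * sgn {v - (0, 1)} {p} * sgn {v - (0, 1)} {p})
      * sgn_mul_self {v - (1, 0)} {p}
    + (sgn {v} {p} * sgn {v} {p}) * sgn_mul_self {v - (0, 1)} {p} + sgn_mul_self {v} {p}

/-- A finitely supported `ℤ/2`-valued cocycle on the square lattice is the coboundary of a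
finitely supported function. -/
theorem exists_potential (s : Edge → ℂ) (hs : ∀ e, s e = 1 ∨ s e = -1) (M : ℤ)
    (hM : ∀ a b i, s ((a, b), i) ≠ 1 → -M ≤ a ∧ a < M ∧ -M ≤ b ∧ b < M)
    (hc : ∀ p, s (p, false) * s (p, true) * s (p + (0, 1), false) * s (p + (1, 0), true) = 1) :
    ∃ V : Finset (ℤ × ℤ), ∀ u, s (u, false) = sgn {u} V * sgn {u + (1, 0)} V ∧
      s (u, true) = sgn {u} V * sgn {u + (0, 1)} V := by
  have hs2 : ∀ e, s e * s e = 1 := fun e => by rcases hs e with h | h <;> simp [h]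
  have hout : ∀ a b i, (a < -M ∨ M ≤ a ∨ b < -M ∨ M ≤ b) → s ((a, b), i) = 1 := by
    intro a b i h
    by_contra h'
    have := hM a b i h'
    omega
  -- The potential is the product of `s` along the horizontal path from `(a, b)` to the right, out
  -- of the support. `Int.toNat` makes the path empty for `M ≤ a`.
  let h : ℤ → ℤ → ℂ := fun a b => ∏ k ∈ Finset.range (M - a).toNat, s ((a + k, b), false)
  have h_pm : ∀ a b, h a b = 1 ∨ h a b = -1 := fun a b =>
    Finset.prod_induction _ (fun z : ℂ => z = 1 ∨ z = -1)
      (by rintro _ _ (rfl | rfl) (rfl | rfl) <;> simp) (Or.inl rfl) fun k _ => hs _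
  have h_sq : ∀ a b, h a b * h a b = 1 := fun a b => by rcases h_pm a b with h | h <;> simp [h]
  have h_right : ∀ a b, M ≤ a → h a b = 1 := by
    intro a b hab
    simp [h, Int.toNat_of_nonpos (sub_nonpos.mpr hab)]
  have h_hor : ∀ a b, h a b = s ((a, b), false) * h (a + 1) b := by
    intro a b
    rcases lt_or_ge a M with hab | hab
    · have : (M - a).toNat = (M - (a + 1)).toNat + 1 := by omega
      simp only [h]
      rw [this, Finset.prod_range_succ']
      simp only [Nat.cast_add, Nat.cast_one, Nat.cast_zero, add_zero]
      rw [mul_comm]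
      congr 1
      refine Finset.prod_congr rfl fun k _ => ?_
      rw [add_assoc, add_comm (k : ℤ) 1]
    · rw [h_right a b hab, h_right (a + 1) b (by omega), hout a b _ (by omega), mul_one]
  -- Induction on the distance to the right boundary: the cocycle condition on the face at `(a, b)`
  -- carries the vertical relation from column `a + 1` to column `a`.
  have h_ver : ∀ (n : ℕ) (a b : ℤ), M - a ≤ n → h a b = s ((a, b), true) * h a (b + 1) := by
    intro n
    induction n with
    | zero =>
      intro a b hab
      push_cast at hab
      rw [h_right a b (by omega), h_right a (b + 1) (by omega), hout a b _ (by omega), mul_one]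
    | succ n ih =>
      intro a b hab
      push_cast at hab
      have h1 := ih (a + 1) b (by omega)
      have h2 := hc (a, b)
      simp only [Prod.mk_add_mk, add_zero] at h2
      rw [h_hor a b, h_hor a (b + 1), h1]
      linear_combination (s ((a, b + 1), false) * s ((a, b), true) * h (a + 1) (b + 1)) * h2
        - (s ((a, b), false) * s ((a + 1, b), true) * h (a + 1) (b + 1)
          * s ((a, b), true) * s ((a, b), true)) * hs2 ((a, b + 1), false)
        - (s ((a, b), false) * s ((a + 1, b), true) * h (a + 1) (b + 1)) * hs2 ((a, b), true)
  have h_ver' : ∀ a b, h a b = s ((a, b), true) * h a (b + 1) := fun a b =>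
    h_ver (M - a).toNat a b (Int.self_le_toNat _)
  have h_row : ∀ a b, (b < -M ∨ M ≤ b) → h a b = 1 := fun a b hb =>
    Finset.prod_eq_one fun k _ => hout _ _ _ (by omega)
  -- Left of the support the potential is the product over a whole row. It does not depend on the
  -- row, since vertical edges there carry `s = 1`, and it is 1 in the rows above the support. This
  -- makes `V` finite.
  have h_left : ∀ (n : ℕ) (a b : ℤ), a < -M → M - b ≤ n → h a b = 1 := by
    intro n
    induction n with
    | zero => exact fun a b _ hb => h_row a b (Or.inr (by push_cast at hb; omega))
    | succ n ih =>
      intro a b ha hb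
      push_cast at hb
      rw [h_ver', hout a b _ (by omega), one_mul, ih a (b + 1) ha (by omega)]
  have h_box : ∀ a b, h a b ≠ 1 → -M ≤ a ∧ a < M ∧ -M ≤ b ∧ b < M := by
    intro a b hab
    by_contra hcon
    refine hab ?_
    by_cases h1 : b < -M ∨ M ≤ b
    · exact h_row a b h1
    · by_cases h2 : M ≤ a
      · exact h_right a b h2
      · exact h_left (M - b).toNat a b (by omega) (Int.self_le_toNat _)
  let V : Finset (ℤ × ℤ) :=
    (Finset.Ico (-M) M ×ˢ Finset.Ico (-M) M).filter fun u => h u.1 u.2 ≠ 1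
  have hV : ∀ u : ℤ × ℤ, sgn {u} V = h u.1 u.2 := by
    intro u
    rw [sgn_singleton_left]
    by_cases hu : h u.1 u.2 = 1
    · rw [if_neg, hu]
      simp [V, hu]
    · rw [if_pos, (h_pm _ _).resolve_left hu]
      have := h_box u.1 u.2 hu
      simp [V, hu]
      omega
  refine ⟨V, fun u => ⟨?_, ?_⟩⟩
  · rw [hV, hV, h_hor u.1 u.2]
    simp only [Prod.fst_add, Prod.snd_add, add_zero]
    linear_combination -s (u, false) * h_sq (u.1 + 1) u.2
  · rw [hV, hV, h_ver' u.1 u.2]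
    simp only [Prod.fst_add, Prod.snd_add, add_zero]
    linear_combination -s (u, true) * h_sq u.1 (u.2 + 1)

theorem eq_of_forall_sgn {Γ : Type*} [DecidableEq Γ] {X Y : Finset Γ}
    (h : ∀ e, sgn {e} X = sgn {e} Y) : X = Y := by
  ext e
  have := h e
  rw [sgn_singleton_left, sgn_singleton_left] at this
  by_cases h1 : e ∈ X <;> by_cases h2 : e ∈ Y <;> simp [h1, h2] at this ⊢ <;> norm_num at this

theorem exists_edge_bound (X : Finset Edge) :
    ∃ M : ℤ, ∀ a b i, ((a, b), i) ∈ X → -M < a ∧ a < M ∧ -M < b ∧ b < M := by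
  refine ⟨∑ e ∈ X, (|e.1.1| + |e.1.2|) + 1, fun a b i h => ?_⟩
  have := Finset.single_le_sum (f := fun e : Edge => |e.1.1| + |e.1.2|)
    (fun _ _ => by positivity) h
  simp only at this
  have h1 := abs_nonneg a
  have h2 := abs_nonneg b
  have h3 := neg_abs_le a
  have h4 := neg_abs_le b
  have h5 := le_abs_self a
  have h6 := le_abs_self b
  omega

/-- The product of the stars at the vertices in `V` has as its support the coboundary of `V`. -/
theorem exists_star_product (V : Finset (ℤ × ℤ)) :
    ∃ X : Finset Edge, word X ∅ ∈ stabilizerProducts ∧ ∀ u,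
      sgn {(u, false)} X = sgn {u} V * sgn {u + (1, 0)} V ∧
      sgn {(u, true)} X = sgn {u} V * sgn {u + (0, 1)} V := by
  induction V using Finset.induction_on with
  | empty => exact ⟨∅, word_empty (Γ := Edge) ▸ one_mem _, by simp⟩
  | insert v V hv ih =>
    obtain ⟨X, hX, h⟩ := ih
    refine ⟨symmDiff (starAt v) X, ?_, fun u => ?_⟩
    · have h1 := word_mul (starAt v) ∅ X ∅
      rw [sgn_empty_right, one_smul, symmDiff_self, ← starOp_eq] at h1
      exact h1 ▸ mul_mem (Submonoid.subset_closure (Or.inl ⟨v, rfl⟩)) hX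
    · rw [← symmDiff_singleton hv]
      simp only [sgn_symmDiff_right, sgn_singleton_starAt_false, sgn_singleton_starAt_true,
        (h u).1, (h u).2]
      constructor <;> ring

theorem exists_plaquette_product (V : Finset (ℤ × ℤ)) :
    ∃ Z : Finset Edge, word ∅ Z ∈ stabilizerProducts ∧ ∀ u,
      sgn {(u, false)} Z = sgn {u} V * sgn {u - (0, 1)} V ∧
      sgn {(u, true)} Z = sgn {u} V * sgn {u - (1, 0)} V := by
  induction V using Finset.induction_on with
  | empty => exact ⟨∅, word_empty (Γ := Edge) ▸ one_mem _, by simp⟩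
  | insert v V hv ih =>
    obtain ⟨Z, hZ, h⟩ := ih
    refine ⟨symmDiff (plaquetteAt v) Z, ?_, fun u => ?_⟩
    · have h1 := word_mul ∅ (plaquetteAt v) ∅ Z
      rw [sgn_empty_left, one_smul, symmDiff_self, ← plaquetteOp_eq] at h1
      exact h1 ▸ mul_mem (Submonoid.subset_closure (Or.inr ⟨v, rfl⟩)) hZ
    · rw [← symmDiff_singleton hv]
      simp only [sgn_symmDiff_right, sgn_singleton_plaquetteAt_false,
        sgn_singleton_plaquetteAt_true, (h u).1, (h u).2]
      constructor <;> ring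

/-- A set of edges that meets every plaquette in an even number of edges is a sum of stars. -/
theorem word_x_mem_stabilizerProducts (X : Finset Edge) (hX : ∀ p, sgn (plaquetteAt p) X = 1) :
    word X ∅ ∈ stabilizerProducts := by
  obtain ⟨M, hM⟩ := exists_edge_bound X
  obtain ⟨V, hV⟩ := exists_potential (fun e => sgn {e} X) (fun e => sgn_eq_or _ _) M
    (fun a b i h => by
      have : ((a, b), i) ∈ X := by
        by_contra h'
        exact h (by simp [sgn_singleton_left, h'])
      have := hM a b i this
      omega) (fun p => by rw [← sgn_plaquetteAt, hX])
  obtain ⟨X', hX', h'⟩ := exists_star_product V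
  have : X = X' := eq_of_forall_sgn fun e => by
    obtain ⟨u, i⟩ := e
    cases i
    · rw [(h' u).1]; exact (hV u).1
    · rw [(h' u).2]; exact (hV u).2
  exact this ▸ hX'

/-- A set of edges that meets every star in an even number of edges is a sum of plaquettes. -/
theorem word_z_mem_stabilizerProducts (Z : Finset Edge) (hZ : ∀ v, sgn (starAt v) Z = 1) :
    word ∅ Z ∈ stabilizerProducts := by
  obtain ⟨M, hM⟩ := exists_edge_bound Z
  -- Passage to the dual lattice: `s` at an edge is the sign of a perpendicular edge of `Z`, shifted
  -- so that the face `p` for `s` becomes the star of `p + (1, 1)` for `Z`. The shift costs one unit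
  -- in the support bound, hence `M + 1` below.
  let s : Edge → ℂ := fun e =>
    if e.2 then sgn {(e.1 + (0, 1), false)} Z else sgn {(e.1 + (1, 0), true)} Z
  obtain ⟨V, hV⟩ := exists_potential s
    (fun e => by simp only [s]; split_ifs <;> exact sgn_eq_or _ _) (M + 1)
    (fun a b i h => by
      cases i
      · have : ((a + 1, b), true) ∈ Z := by
          by_contra h'
          exact h (by simp [s, sgn_singleton_left, h'])
        have := hM _ _ _ this
        omega
      · have : ((a, b + 1), false) ∈ Z := by
          by_contra h'
          exact h (by simp [s, sgn_singleton_left, h'])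
        have := hM _ _ _ this
        omega)
    (fun p => by
      have := hZ (p + (0, 1) + (1, 0))
      rw [sgn_starAt] at this
      simp only [add_sub_cancel_right, s, Bool.false_eq_true, if_false, if_true] at this ⊢
      rw [show p + (0, 1) + (1, 0) - (0, 1) = p + (1, 0) by abel] at this
      rw [add_right_comm p (1, 0) (0, 1)]
      linear_combination this)
  obtain ⟨Z', hZ', h'⟩ := exists_plaquette_product V
  have : Z = Z' := eq_of_forall_sgn fun e => by
    obtain ⟨u, i⟩ := e
    cases i
    · rw [(h' u).1]
      have := (hV (u - (0, 1))).2
      simp only [s, if_true, sub_add_cancel] at this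
      rw [this, mul_comm]
    · rw [(h' u).2]
      have := (hV (u - (1, 0))).1
      simp only [s, Bool.false_eq_true, if_false, sub_add_cancel] at this
      rw [this, mul_comm]
  exact this ▸ hZ'

/-- A Pauli word that commutes with all stars and plaquettes is a product of stars and
plaquettes. -/
theorem word_mem_stabilizerProducts (X Z : Finset Edge) (hX : ∀ p, sgn (plaquetteAt p) X = 1)
    (hZ : ∀ v, sgn (starAt v) Z = 1) : word X Z ∈ stabilizerProducts := by
  have := word_mul ∅ Z X ∅
  rw [sgn_empty_left, one_smul, ← Finset.bot_eq_empty, symmDiff_bot, bot_symmDiff] at this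
  exact this ▸ mul_mem (word_z_mem_stabilizerProducts Z hZ) (word_x_mem_stabilizerProducts X hX)

/-! ### Strings -/

theorem exists_upper_bound (F : Finset (ℤ × ℤ)) : ∃ M : ℤ, ∀ v ∈ F, v.1 < M := by
  refine ⟨∑ v ∈ F, |v.1| + 1, fun v hv => ?_⟩
  have := Finset.single_le_sum (f := fun v : ℤ × ℤ => |v.1|) (fun _ _ => abs_nonneg _) hv
  exact Int.lt_add_one_iff.mpr ((le_abs_self v.1).trans this)

/-- A horizontal string of edges from `v` to the right meets only the stars of its two ends in an
odd number of edges. The far end lies in column `M`, beyond all of `F`. If `v` is not left of column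
`M`, the string is empty and `v` is not in `F`. -/
theorem exists_star_string (F : Finset (ℤ × ℤ)) (v : ℤ × ℤ) :
    ∃ Z : Finset Edge, ∀ w ∈ F, sgn (starAt w) Z = sgn {w} {v} := by
  obtain ⟨M, hM⟩ := exists_upper_bound F
  refine ⟨(Finset.Ico v.1 M ×ˢ {v.2}) ×ˢ {false}, fun w hw => ?_⟩
  have := hM w hw
  rw [sgn_starAt]
  simp only [sgn_singleton_left, Finset.mem_product, Finset.mem_Ico, Finset.mem_singleton,
    Prod.fst_sub, Prod.snd_sub, sub_zero, Prod.ext_iff, Bool.true_eq_false, and_false, if_false,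
    and_true, mul_one]
  split_ifs <;> first | omega | norm_num

/-- The dual string: a row of vertical edges to the right of the face `p`. The interval is open on
the left because the edge shared by `p` and its right neighbour has first coordinate `p.1 + 1`. -/
theorem exists_plaquette_string (F : Finset (ℤ × ℤ)) (p : ℤ × ℤ) :
    ∃ X : Finset Edge, ∀ q ∈ F, sgn (plaquetteAt q) X = sgn {q} {p} := by
  obtain ⟨M, hM⟩ := exists_upper_bound F
  refine ⟨(Finset.Ioc p.1 M ×ˢ {p.2}) ×ˢ {true}, fun w hw => ?_⟩
  have := hM w hw
  rw [sgn_plaquetteAt]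
  simp only [sgn_singleton_left, Finset.mem_product, Finset.mem_Ioc, Finset.mem_singleton,
    Prod.fst_add, Prod.snd_add, add_zero, Prod.ext_iff, Bool.false_eq_true, and_false, if_false,
    and_true, mul_one, one_mul]
  split_ifs <;> first | omega | norm_num

theorem exists_star_flips (F D : Finset (ℤ × ℤ)) :
    ∃ Z : Finset Edge, ∀ w ∈ F, sgn (starAt w) Z = sgn {w} D := by
  induction D using Finset.induction_on with
  | empty => exact ⟨∅, by simp⟩
  | insert v D hv ih =>
    obtain ⟨Z, hZ⟩ := ih
    obtain ⟨Z', hZ'⟩ := exists_star_string F v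
    exact ⟨symmDiff Z' Z, fun w hw => by
      rw [← symmDiff_singleton hv, sgn_symmDiff_right, sgn_symmDiff_right, hZ w hw, hZ' w hw]⟩

theorem exists_plaquette_flips (F D : Finset (ℤ × ℤ)) :
    ∃ X : Finset Edge, ∀ q ∈ F, sgn (plaquetteAt q) X = sgn {q} D := by
  induction D using Finset.induction_on with
  | empty => exact ⟨∅, by simp⟩
  | insert v D hv ih =>
    obtain ⟨X, hX⟩ := ih
    obtain ⟨X', hX'⟩ := exists_plaquette_string F v
    exact ⟨symmDiff X' X, fun w hw => by
      rw [← symmDiff_singleton hv, sgn_symmDiff_right, sgn_symmDiff_right, hX w hw, hX' w hw]⟩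

/-! ### Evolution under a bounded Hamiltonian -/

section Evolution

variable {A : Type*} [CStarAlgebra A]

/-- The evolution `exp(i t h) a exp(-i t h)`. -/
def evol (h : A) (t : ℝ) (a : A) : A :=
  NormedSpace.exp ((Complex.I * t) • h) * a * NormedSpace.exp (-(Complex.I * t) • h)

theorem exp_smul_mul_exp_smul (h : A) (s t : ℂ) :
    NormedSpace.exp (s • h) * NormedSpace.exp (t • h) = NormedSpace.exp ((s + t) • h) := by
  let +nondep : NormedAlgebra ℚ A := .restrictScalars ℚ ℂ A
  rw [add_smul]
  exact (NormedSpace.exp_add_of_commute ((Commute.refl h).smul_left s |>.smul_right t)).symm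

theorem exp_neg_smul_mul_exp_smul (h : A) (t : ℂ) :
    NormedSpace.exp (-t • h) * NormedSpace.exp (t • h) = 1 := by
  rw [exp_smul_mul_exp_smul, neg_add_cancel, zero_smul, NormedSpace.exp_zero]

theorem exp_smul_mul_exp_neg_smul (h : A) (t : ℂ) :
    NormedSpace.exp (t • h) * NormedSpace.exp (-t • h) = 1 := by
  rw [exp_smul_mul_exp_smul, add_neg_cancel, zero_smul, NormedSpace.exp_zero]

theorem evol_add (h : A) (t : ℝ) (a b : A) : evol h t (a + b) = evol h t a + evol h t b := by
  simp only [evol, mul_add, add_mul]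

theorem evol_sub (h : A) (t : ℝ) (a b : A) : evol h t (a - b) = evol h t a - evol h t b := by
  simp only [evol, mul_sub, sub_mul]

theorem evol_smul (h : A) (t : ℝ) (c : ℂ) (a : A) : evol h t (c • a) = c • evol h t a := by
  simp only [evol, mul_smul_comm, smul_mul_assoc]

theorem evol_mul (h : A) (t : ℝ) (a b : A) : evol h t (a * b) = evol h t a * evol h t b := by
  calc evol h t (a * b) = NormedSpace.exp ((Complex.I * t) • h) * a * 1 * b *
        NormedSpace.exp (-(Complex.I * t) • h) := by simp only [evol, mul_one, mul_assoc]
    _ = _ := by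
      rw [← exp_neg_smul_mul_exp_smul h (Complex.I * t)]
      simp only [evol, mul_assoc]

theorem evol_evol (h : A) (s t : ℝ) (a : A) : evol h s (evol h t a) = evol h (s + t) a := by
  have h1 := exp_smul_mul_exp_smul h (Complex.I * s) (Complex.I * t)
  have h2 := exp_smul_mul_exp_smul h (-(Complex.I * t)) (-(Complex.I * s))
  rw [← mul_add] at h1
  rw [← neg_add, add_comm, ← mul_add] at h2
  simp only [evol, Complex.ofReal_add]
  rw [← h1, ← h2]
  simp only [mul_assoc]

theorem evol_zero (h a : A) : evol h 0 a = a := by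
  simp [evol, NormedSpace.exp_zero]

theorem evol_of_commute {h a : A} (ha : Commute h a) (t : ℝ) : evol h t a = a := by
  let +nondep : NormedAlgebra ℚ A := .restrictScalars ℚ ℂ A
  have : Commute (NormedSpace.exp ((Complex.I * t) • h)) a := (ha.smul_left _).exp_left
  rw [evol, this.eq, mul_assoc, exp_smul_mul_exp_neg_smul, mul_one]

/-- The exponential of `h + k` factors, and the factor of `k` passes through `a` and cancels. This
is why distant terms of the Hamiltonian do not affect local observables. -/
theorem evol_add_of_commute {h k a : A} (hk : Commute h k) (ha : Commute k a) (t : ℝ) :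
    evol (h + k) t a = evol h t a := by
  let +nondep : NormedAlgebra ℚ A := .restrictScalars ℚ ℂ A
  have h1 (z : ℂ) : NormedSpace.exp (z • (h + k))
      = NormedSpace.exp (z • h) * NormedSpace.exp (z • k) := by
    rw [smul_add]
    exact NormedSpace.exp_add_of_commute (hk.smul_left z |>.smul_right z)
  have h2 : Commute (NormedSpace.exp (-(Complex.I * t) • h))
      (NormedSpace.exp (-(Complex.I * t) • k)) :=
    ((hk.smul_left _).smul_right _).exp_left.exp_right
  calc
    evol (h + k) t a = NormedSpace.exp ((Complex.I * t) • h) * evol k t a *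
        NormedSpace.exp (-(Complex.I * t) • h) := by
      simp only [evol]
      rw [h1, h1, h2.eq]
      simp only [mul_assoc]
    _ = _ := by rw [evol_of_commute ha, evol]

theorem evol_star {h : A} (hh : IsSelfAdjoint h) (t : ℝ) (a : A) :
    evol h t (star a) = star (evol h t a) := by
  simp [evol, NormedSpace.star_exp, hh.star_eq, mul_assoc]

theorem exp_mem_unitary {h : A} (hh : IsSelfAdjoint h) (t : ℝ) :
    NormedSpace.exp ((Complex.I * t) • h) ∈ unitary A :=
  let +nondep : NormedAlgebra ℚ A := .restrictScalars ℚ ℂ A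
  NormedSpace.exp_mem_unitary_of_mem_skewAdjoint (by simp [skewAdjoint.mem_iff, hh.star_eq])

theorem norm_evol {h : A} (hh : IsSelfAdjoint h) (t : ℝ) (a : A) : ‖evol h t a‖ = ‖a‖ := by
  have h2 := exp_mem_unitary hh (-t)
  rw [Complex.ofReal_neg, mul_neg] at h2
  rw [evol, CStarRing.norm_mul_mem_unitary _ h2,
    CStarRing.norm_mem_unitary_mul _ (exp_mem_unitary hh t)]

theorem hasDerivAt_evol (h : A) (t : ℝ) (a : A) :
    HasDerivAt (fun t => evol h t a)
      (Complex.I • (h * evol h t a - evol h t a * h)) t := by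
  have h1 : HasDerivAt (fun t : ℝ => NormedSpace.exp ((Complex.I * t) • h))
      (Complex.I • h * NormedSpace.exp ((Complex.I * t) • h)) t := by
    have := hasDerivAt_exp_smul_const' (𝕂 := ℝ) (Complex.I • h) t
    refine this.congr_of_eventuallyEq (Filter.Eventually.of_forall fun s => ?_) |>.congr_deriv ?_
    · simp only [← Complex.coe_smul, smul_smul, mul_comm]
    · simp only [← Complex.coe_smul, smul_smul, mul_comm]
  have h2 : HasDerivAt (fun t : ℝ => NormedSpace.exp (-(Complex.I * t) • h))
      (NormedSpace.exp (-(Complex.I * t) • h) * (-Complex.I) • h) t := by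
    have := hasDerivAt_exp_smul_const (𝕂 := ℝ) ((-Complex.I) • h) t
    refine this.congr_of_eventuallyEq (Filter.Eventually.of_forall fun s => ?_) |>.congr_deriv ?_
    · simp only [← Complex.coe_smul, smul_smul, mul_comm, mul_neg]
    · simp only [← Complex.coe_smul, smul_smul, mul_comm, mul_neg]
  refine ((h1.mul_const a).mul h2).congr_deriv ?_
  simp only [evol, smul_sub, neg_smul, mul_neg, mul_smul_comm, smul_mul_assoc, mul_assoc]
  rw [sub_eq_add_neg]

end Evolution

/-! ### Commutation properties of the toric code interaction -/

theorem toricInteraction_cases (Y : Finset Edge) :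
    (∃ v, Y = starAt v ∧ toricInteraction.toFun Y = -word Y ∅) ∨
    (∃ p, Y = plaquetteAt p ∧ toricInteraction.toFun Y = -word ∅ Y) ∨
    toricInteraction.toFun Y = 0 := by
  by_cases h1 : ∃ v, Y = starAt v
  · obtain ⟨v, hv⟩ := h1
    refine Or.inl ⟨v, hv, ?_⟩
    simp only [toricInteraction]
    rw [if_pos ⟨v, hv⟩, pauliMonomial_x]
  · by_cases h2 : ∃ p, Y = plaquetteAt p
    · obtain ⟨p, hp⟩ := h2
      refine Or.inr (Or.inl ⟨p, hp, ?_⟩)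
      simp only [toricInteraction]
      rw [if_neg h1, if_pos ⟨p, hp⟩, pauliMonomial_z]
    · refine Or.inr (Or.inr ?_)
      simp only [toricInteraction]
      rw [if_neg h1, if_neg h2]

theorem word_commute {Γ : Type*} [DecidableEq Γ] {X Z X' Z' : Finset Γ}
    (h : sgn X Z' * sgn Z X' = 1) : Commute (word X Z) (word X' Z') := by
  rw [commute_iff_eq, word_commute_sgn, h, one_smul]

theorem toricInteraction_commute (Y Y' : Finset Edge) :
    Commute (toricInteraction.toFun Y) (toricInteraction.toFun Y') := by
  rcases toricInteraction_cases Y with ⟨v, rfl, h⟩ | ⟨p, rfl, h⟩ | h <;>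
  rcases toricInteraction_cases Y' with ⟨v', rfl, h'⟩ | ⟨p', rfl, h'⟩ | h' <;> rw [h, h'] <;>
  first
  | exact Commute.zero_left _
  | exact Commute.zero_right _
  | exact (word_commute (by
      simp [sgn_starAt_plaquetteAt, sgn_comm (plaquetteAt _)])).neg_left.neg_right

/-- All edges in the stars and plaquettes that contain the edge `e`. -/
def edgeNhd (e : Edge) : Finset Edge :=
  starAt e.1 ∪ starAt (e.1 + (1, 0)) ∪ starAt (e.1 + (0, 1)) ∪
    plaquetteAt e.1 ∪ plaquetteAt (e.1 - (0, 1)) ∪ plaquetteAt (e.1 - (1, 0))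

/-- All edges in the stars and plaquettes that meet `S`. -/
def collar (S : Finset Edge) : Finset Edge := S.biUnion edgeNhd

theorem starAt_subset_edgeNhd {e : Edge} {v : ℤ × ℤ} (h : e ∈ starAt v) :
    starAt v ⊆ edgeNhd e := by
  have : v = e.1 ∨ v = e.1 + (1, 0) ∨ v = e.1 + (0, 1) := by
    obtain ⟨u, i⟩ := e
    cases i
    · rcases (mem_starAt_false _ _).mp h with h | h <;> simp [h]
    · rcases (mem_starAt_true _ _).mp h with h | h <;> simp [h]
  intro x hx
  simp only [edgeNhd, Finset.mem_union]
  rcases this with rfl | rfl | rfl <;> simp [hx]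

theorem plaquetteAt_subset_edgeNhd {e : Edge} {p : ℤ × ℤ} (h : e ∈ plaquetteAt p) :
    plaquetteAt p ⊆ edgeNhd e := by
  have : p = e.1 ∨ p = e.1 - (0, 1) ∨ p = e.1 - (1, 0) := by
    obtain ⟨u, i⟩ := e
    cases i
    · rcases (mem_plaquetteAt_false _ _).mp h with h | h <;> simp [h]
    · rcases (mem_plaquetteAt_true _ _).mp h with h | h <;> simp [h]
  intro x hx
  simp only [edgeNhd, Finset.mem_union]
  rcases this with rfl | rfl | rfl <;> simp [hx]

/-- A star can fail to commute with the word only if it meets `Z`, a plaquette only if it meets `X`.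
In either case it would lie in the collar. -/
theorem toricInteraction_commute_word {X Z Y : Finset Edge} (hY : ¬ Y ⊆ collar (X ∪ Z)) :
    Commute (toricInteraction.toFun Y) (word X Z) := by
  rcases toricInteraction_cases Y with ⟨v, rfl, h⟩ | ⟨p, rfl, h⟩ | h
  · have hd : Disjoint (starAt v) Z := Finset.disjoint_left.mpr fun e he heZ => hY
      ((starAt_subset_edgeNhd he).trans
        (Finset.subset_biUnion_of_mem edgeNhd (Finset.mem_union_right _ heZ)))
    rw [h]
    exact (word_commute (by simp [sgn_of_disjoint hd])).neg_left
  · have hd : Disjoint (plaquetteAt p) X := Finset.disjoint_left.mpr fun e he heX => hY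
      ((plaquetteAt_subset_edgeNhd he).trans
        (Finset.subset_biUnion_of_mem edgeNhd (Finset.mem_union_left _ heX)))
    rw [h]
    exact (word_commute (by simp [sgn_of_disjoint hd])).neg_left
  · rw [h]
    exact Commute.zero_left _

theorem hamiltonian_isSelfAdjoint {Γ : Type*} [DecidableEq Γ] (Φ : Interaction Γ) (Λ : Finset Γ) :
    IsSelfAdjoint (Φ.hamiltonian Λ) :=
  isSelfAdjoint_sum _ fun Y _ => Φ.isSelfAdjoint Y

theorem exists_hamiltonian_eq_add {X Z Λ : Finset Edge} (h : collar (X ∪ Z) ⊆ Λ) :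
    ∃ k, toricInteraction.hamiltonian Λ = toricInteraction.hamiltonian (collar (X ∪ Z)) + k ∧
      Commute (toricInteraction.hamiltonian (collar (X ∪ Z))) k ∧ Commute k (word X Z) := by
  refine ⟨∑ Y ∈ Λ.powerset \ (collar (X ∪ Z)).powerset, toricInteraction.toFun Y, ?_, ?_, ?_⟩
  · rw [Interaction.hamiltonian, Interaction.hamiltonian, add_comm]
    exact (Finset.sum_sdiff (Finset.powerset_mono.mpr h)).symm
  · exact Commute.sum_left _ _ _ fun Y _ => Commute.sum_right _ _ _ fun Y' _ =>
      toricInteraction_commute Y Y'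
  · refine Commute.sum_left _ _ _ fun Y hY => toricInteraction_commute_word ?_
    simp only [Finset.mem_sdiff, Finset.mem_powerset] at hY
    exact hY.2

/-! ### The dynamics of an interaction with eventually constant local dynamics -/

section Limit

open Filter Topology

variable {Γ : Type*} [DecidableEq Γ]

theorem localDynamics_eq (Φ : Interaction Γ) (Λ : Finset Γ) (t : ℝ) (a : QuasiLocal Γ) :
    Φ.localDynamics Λ t a = evol (Φ.hamiltonian Λ) t a := rfl

/-- The interaction `Φ` does not propagate: the local dynamics of every local observable is
eventually constant. -/
def IsLocalizing (Φ : Interaction Γ) : Prop :=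
  ∀ a ∈ wordSpan Γ, ∃ F : Finset Γ, ∀ Λ, F ⊆ Λ →
    (∀ t, Φ.localDynamics Λ t a = Φ.localDynamics F t a) ∧
    Φ.localDerivation Λ a = Φ.localDerivation F a

variable {Φ : Interaction Γ}

/-- Approximation by an element of the word span, whose evolution is eventually constant. The error
is uniform in `Λ` because every local evolution is isometric. -/
theorem IsLocalizing.exists_tendsto (hΦ : IsLocalizing Φ) (t : ℝ) (a : QuasiLocal Γ) :
    ∃ b, Tendsto (fun Λ => Φ.localDynamics Λ t a) atTop (𝓝 b) := by
  refine cauchySeq_tendsto_of_complete (Metric.cauchySeq_iff'.mpr fun ε hε => ?_)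
  obtain ⟨b, hb, hab⟩ := Metric.dense_iff.mp dense_wordSpan a (ε / 2) (half_pos hε)
  obtain ⟨F, hF⟩ := hΦ b hab
  refine ⟨F, fun Λ hΛ => ?_⟩
  rw [Metric.mem_ball, dist_comm, dist_eq_norm] at hb
  have h1 (Λ : Finset Γ) : ‖Φ.localDynamics Λ t a - Φ.localDynamics Λ t b‖ < ε / 2 := by
    rwa [localDynamics_eq, localDynamics_eq, ← evol_sub,
      norm_evol (hamiltonian_isSelfAdjoint Φ Λ)]
  have h2 := h1 Λ
  rw [(hF Λ hΛ).1 t] at h2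
  have h3 := h1 F
  rw [← dist_eq_norm] at h2 h3
  rw [dist_comm] at h3
  linarith [dist_triangle (Φ.localDynamics Λ t a) (Φ.localDynamics F t b)
    (Φ.localDynamics F t a)]

end Limit

section Limit

open Filter Topology

variable {Γ : Type*} [DecidableEq Γ] {Φ : Interaction Γ}

/-- The thermodynamic limit of the local dynamics, as a map. -/
def limitMap (hΦ : IsLocalizing Φ) (t : ℝ) (a : QuasiLocal Γ) : QuasiLocal Γ :=
  (hΦ.exists_tendsto t a).choose

theorem tendsto_limitMap (hΦ : IsLocalizing Φ) (t : ℝ) (a : QuasiLocal Γ) :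
    Tendsto (fun Λ => Φ.localDynamics Λ t a) atTop (𝓝 (limitMap hΦ t a)) :=
  (hΦ.exists_tendsto t a).choose_spec

theorem limitMap_eq (hΦ : IsLocalizing Φ) {t : ℝ} {a b : QuasiLocal Γ}
    (h : Tendsto (fun Λ => Φ.localDynamics Λ t a) atTop (𝓝 b)) : limitMap hΦ t a = b :=
  tendsto_nhds_unique (tendsto_limitMap hΦ t a) h

theorem limitMap_add (hΦ : IsLocalizing Φ) (t : ℝ) (a b : QuasiLocal Γ) :
    limitMap hΦ t (a + b) = limitMap hΦ t a + limitMap hΦ t b :=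
  limitMap_eq hΦ (((tendsto_limitMap hΦ t a).add (tendsto_limitMap hΦ t b)).congr fun Λ => by
    simp only [localDynamics_eq, evol_add])

theorem limitMap_mul (hΦ : IsLocalizing Φ) (t : ℝ) (a b : QuasiLocal Γ) :
    limitMap hΦ t (a * b) = limitMap hΦ t a * limitMap hΦ t b :=
  limitMap_eq hΦ (((tendsto_limitMap hΦ t a).mul (tendsto_limitMap hΦ t b)).congr fun Λ => by
    simp only [localDynamics_eq, evol_mul])

theorem limitMap_smul (hΦ : IsLocalizing Φ) (t : ℝ) (c : ℂ) (a : QuasiLocal Γ) :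
    limitMap hΦ t (c • a) = c • limitMap hΦ t a :=
  limitMap_eq hΦ (((tendsto_limitMap hΦ t a).const_smul c).congr fun Λ => by
    simp only [localDynamics_eq, evol_smul])

theorem limitMap_star (hΦ : IsLocalizing Φ) (t : ℝ) (a : QuasiLocal Γ) :
    limitMap hΦ t (star a) = star (limitMap hΦ t a) :=
  limitMap_eq hΦ ((tendsto_limitMap hΦ t a).star.congr fun Λ => by
    simp only [localDynamics_eq, evol_star (hamiltonian_isSelfAdjoint Φ Λ)])

theorem norm_limitMap (hΦ : IsLocalizing Φ) (t : ℝ) (a : QuasiLocal Γ) :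
    ‖limitMap hΦ t a‖ = ‖a‖ :=
  tendsto_nhds_unique (tendsto_limitMap hΦ t a).norm
    (tendsto_const_nhds.congr fun Λ => by
      rw [localDynamics_eq, norm_evol (hamiltonian_isSelfAdjoint Φ Λ)])

theorem limitMap_sub (hΦ : IsLocalizing Φ) (t : ℝ) (a b : QuasiLocal Γ) :
    limitMap hΦ t (a - b) = limitMap hΦ t a - limitMap hΦ t b :=
  limitMap_eq hΦ (((tendsto_limitMap hΦ t a).sub (tendsto_limitMap hΦ t b)).congr fun Λ => by
    simp only [localDynamics_eq, evol_sub])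

theorem limitMap_zero (hΦ : IsLocalizing Φ) (a : QuasiLocal Γ) : limitMap hΦ 0 a = a :=
  limitMap_eq hΦ (tendsto_const_nhds.congr fun Λ => by rw [localDynamics_eq, evol_zero])

theorem limitMap_limitMap (hΦ : IsLocalizing Φ) (s t : ℝ) (a : QuasiLocal Γ) :
    limitMap hΦ s (limitMap hΦ t a) = limitMap hΦ (s + t) a := by
  refine (limitMap_eq hΦ ?_).symm
  have h1 := tendsto_limitMap hΦ s (limitMap hΦ t a)
  -- Replacing the inner local evolution by its limit costs an error that the isometric outer
  -- evolution does not enlarge.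
  have h2 : Tendsto (fun Λ => Φ.localDynamics Λ s (Φ.localDynamics Λ t a)
      - Φ.localDynamics Λ s (limitMap hΦ t a)) atTop (𝓝 0) := by
    rw [tendsto_zero_iff_norm_tendsto_zero]
    have h3 := ((tendsto_limitMap hΦ t a).sub_const (limitMap hΦ t a)).norm
    rw [sub_self, norm_zero] at h3
    refine h3.congr fun Λ => ?_
    simp only [localDynamics_eq]
    rw [← evol_sub, norm_evol (hamiltonian_isSelfAdjoint Φ Λ)]
  have h4 := h1.add h2
  rw [add_zero] at h4
  refine h4.congr fun Λ => ?_
  simp only [localDynamics_eq, evol_evol]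
  abel

/-- The thermodynamic limit of the local dynamics, as a one-parameter family of automorphisms. -/
def limitDynamics (hΦ : IsLocalizing Φ) (t : ℝ) : QuasiLocal Γ ≃⋆ₐ[ℂ] QuasiLocal Γ where
  toFun := limitMap hΦ t
  invFun := limitMap hΦ (-t)
  left_inv a := by rw [limitMap_limitMap, neg_add_cancel, limitMap_zero]
  right_inv a := by rw [limitMap_limitMap, add_neg_cancel, limitMap_zero]
  map_mul' := limitMap_mul hΦ t
  map_add' := limitMap_add hΦ t
  map_star' := limitMap_star hΦ t
  map_smul' := limitMap_smul hΦ t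

theorem limitMap_eq_evol (hΦ : IsLocalizing Φ) {a : QuasiLocal Γ} {F : Finset Γ} {t : ℝ}
    (hF : ∀ Λ, F ⊆ Λ → Φ.localDynamics Λ t a = Φ.localDynamics F t a) :
    limitMap hΦ t a = evol (Φ.hamiltonian F) t a :=
  limitMap_eq hΦ (tendsto_const_nhds.congr'
    ((eventually_ge_atTop F).mono fun Λ hΛ => (hF Λ hΛ).symm))

theorem continuous_limitMap (hΦ : IsLocalizing Φ) (a : QuasiLocal Γ) :
    Continuous fun t => limitMap hΦ t a := by
  rw [Metric.continuous_iff]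
  intro t ε hε
  obtain ⟨b, hb, hab⟩ := Metric.dense_iff.mp dense_wordSpan a (ε / 3) (by positivity)
  obtain ⟨F, hF⟩ := hΦ b hab
  have hcont : Continuous fun t => limitMap hΦ t b := by
    have : (fun t => limitMap hΦ t b) = fun t => evol (Φ.hamiltonian F) t b :=
      funext fun t => limitMap_eq_evol hΦ fun Λ hΛ => (hF Λ hΛ).1 t
    rw [this]
    exact continuous_iff_continuousAt.mpr fun t => (hasDerivAt_evol _ t b).continuousAt
  obtain ⟨δ, hδ, h⟩ := Metric.continuous_iff.mp hcont t (ε / 3) (by positivity)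
  refine ⟨δ, hδ, fun s hs => ?_⟩
  have h1 (t : ℝ) : dist (limitMap hΦ t b) (limitMap hΦ t a) < ε / 3 := by
    rw [dist_eq_norm, ← limitMap_sub, norm_limitMap, ← dist_eq_norm]
    exact hb
  have h2 := h1 s
  rw [dist_comm] at h2
  have h3 := dist_triangle4 (limitMap hΦ s a) (limitMap hΦ s b) (limitMap hΦ t b) (limitMap hΦ t a)
  linarith [h1 t, h s hs]

theorem isDynamics_limitDynamics (hΦ : IsLocalizing Φ) : Φ.IsDynamics (limitDynamics hΦ) where
  map_add s t a := (limitMap_limitMap hΦ s t a).symm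
  continuous := continuous_limitMap hΦ
  tendsto := tendsto_limitMap hΦ
  generator Λ₀ a ha := by
    obtain ⟨F, hF⟩ := hΦ a (localAlgebra_le_wordAlgebra Λ₀ ha)
    refine ⟨Φ.localDerivation F a, tendsto_const_nhds.congr'
      ((eventually_ge_atTop F).mono fun Λ hΛ => ((hF Λ hΛ).2).symm), ?_⟩
    have : (fun t => limitDynamics hΦ t a) = fun t => evol (Φ.hamiltonian F) t a :=
      funext fun t => limitMap_eq_evol hΦ fun Λ hΛ => (hF Λ hΛ).1 t
    rw [this]
    refine (hasDerivAt_evol _ 0 a).congr_deriv ?_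
    rw [evol_zero]
    rfl

theorem isDynamics_unique {α β : ℝ → (QuasiLocal Γ ≃⋆ₐ[ℂ] QuasiLocal Γ)}
    (hα : Φ.IsDynamics α) (hβ : Φ.IsDynamics β) : α = β :=
  funext fun t => StarAlgEquiv.ext fun a =>
    tendsto_nhds_unique (hα.tendsto t a) (hβ.tendsto t a)

end Limit

/-! ### The dynamics of the toric code. -/

theorem localDynamics_word {X Z Λ : Finset Edge} (h : collar (X ∪ Z) ⊆ Λ) (t : ℝ) :
    toricInteraction.localDynamics Λ t (word X Z)
      = evol (toricInteraction.hamiltonian (collar (X ∪ Z))) t (word X Z) := by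
  obtain ⟨k, hk, h1, h2⟩ := exists_hamiltonian_eq_add h
  rw [localDynamics_eq, hk, evol_add_of_commute h1 h2]

/-- For a word its collar serves as the finite set, since the added part of the Hamiltonian commutes
both with the rest and with the word. Sums use the union of the two sets. -/
theorem isLocalizing_toricInteraction : IsLocalizing toricInteraction := by
  intro a ha
  refine wordSpan_induction (p := fun a => ∃ F : Finset Edge, ∀ Λ, F ⊆ Λ →
    (∀ t, toricInteraction.localDynamics Λ t a = toricInteraction.localDynamics F t a) ∧
    toricInteraction.localDerivation Λ a = toricInteraction.localDerivation F a)
    (fun X Z => ?_) ?_ ?_ ?_ ha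
  · refine ⟨collar (X ∪ Z), fun Λ hΛ => ⟨fun t => localDynamics_word hΛ t, ?_⟩⟩
    obtain ⟨k, hk, h1, h2⟩ := exists_hamiltonian_eq_add hΛ
    simp only [Interaction.localDerivation]
    rw [hk, add_mul, mul_add, h2.eq, add_sub_add_right_eq_sub]
  · exact ⟨∅, fun Λ _ => ⟨fun t => by simp [localDynamics_eq, evol], by
      simp [Interaction.localDerivation]⟩⟩
  · rintro a b ⟨F, hF⟩ ⟨G, hG⟩
    refine ⟨F ∪ G, fun Λ hΛ => ?_⟩
    have h1 := hF Λ (Finset.union_subset_left hΛ)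
    have h2 := hG Λ (Finset.union_subset_right hΛ)
    have h3 := hF (F ∪ G) Finset.subset_union_left
    have h4 := hG (F ∪ G) Finset.subset_union_right
    have hd (Λ : Finset Edge) : toricInteraction.localDerivation Λ (a + b) =
        toricInteraction.localDerivation Λ a + toricInteraction.localDerivation Λ b := by
      simp only [Interaction.localDerivation, mul_add, add_mul, smul_sub, smul_add]
      abel
    refine ⟨fun t => ?_, ?_⟩
    · have h1 := h1.1 t
      have h2 := h2.1 t
      have h3 := h3.1 t
      have h4 := h4.1 t
      simp only [localDynamics_eq, evol_add] at *
      rw [h1, h2, h3, h4]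
    · rw [hd, hd, h1.2, h2.2, h3.2, h4.2]
  · rintro c a ⟨F, hF⟩
    refine ⟨F, fun Λ hΛ => ⟨fun t => ?_, ?_⟩⟩
    · have h1 := (hF Λ hΛ).1 t
      simp only [localDynamics_eq, evol_smul] at *
      rw [h1]
    · have h1 := (hF Λ hΛ).2
      simp only [Interaction.localDerivation, mul_smul_comm, smul_mul_assoc, ← smul_sub] at *
      rw [smul_comm, h1, smul_comm]

/-- The toric code dynamics. -/
def toricDynamics : ℝ → (ToricAlgebra ≃⋆ₐ[ℂ] ToricAlgebra) :=
  limitDynamics isLocalizing_toricInteraction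

theorem isDynamics_toricDynamics : toricInteraction.IsDynamics toricDynamics :=
  isDynamics_limitDynamics _

theorem toricDynamics_word (t : ℝ) (X Z : Finset Edge) : toricDynamics t (word X Z)
    = evol (toricInteraction.hamiltonian (collar (X ∪ Z))) t (word X Z) :=
  limitMap_eq_evol isLocalizing_toricInteraction fun _ hΛ =>
    (localDynamics_word hΛ t).trans (localDynamics_word le_rfl t).symm

/-! ### Positivity of generators -/

section Generator

variable {H : Type*} [NormedAddCommGroup H] [InnerProductSpace ℂ H]

/-- The joint eigenspace of the unitaries `U t` with the eigenvalues `exp(i n t)`. -/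
def eigenSubmodule (U : ℝ → (H ≃ₗᵢ[ℂ] H)) (n : ℕ) : Submodule ℂ H where
  carrier := {ψ | ∀ t, U t ψ = Complex.exp (Complex.I * n * t) • ψ}
  zero_mem' := by simp
  add_mem' hψ hφ t := by rw [map_add, hψ t, hφ t, smul_add]
  smul_mem' c ψ hψ t := by rw [map_smul, hψ t, smul_comm]

theorem isClosed_eigenSubmodule (U : ℝ → (H ≃ₗᵢ[ℂ] H)) (n : ℕ) :
    IsClosed (eigenSubmodule U n : Set H) := by
  have : (eigenSubmodule U n : Set H)
      = ⋂ t : ℝ, {ψ | U t ψ = Complex.exp (Complex.I * n * t) • ψ} := by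
    ext ψ
    simp [eigenSubmodule]
  rw [this]
  exact isClosed_iInter fun t => isClosed_eq (U t).continuous (by fun_prop)

theorem inner_apply_of_mem_eigenSubmodule {U : ℝ → (H ≃ₗᵢ[ℂ] H)} {n : ℕ} {e : H}
    (he : e ∈ eigenSubmodule U n) (t : ℝ) (ψ : H) :
    inner ℂ e (U t ψ) = Complex.exp (Complex.I * n * t) * inner ℂ e ψ := by
  have h1 : inner ℂ (U t e) (U t ψ) = inner ℂ e ψ := (U t).inner_map_map e ψ
  rw [he t, inner_smul_left, ← Complex.exp_conj] at h1
  rw [← h1, ← mul_assoc, ← Complex.exp_add]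
  simp

theorem orthogonalFamily_eigenSubmodule (U : ℝ → (H ≃ₗᵢ[ℂ] H)) :
    OrthogonalFamily ℂ (fun n => eigenSubmodule U n) fun n => (eigenSubmodule U n).subtypeₗᵢ := by
  intro m n hmn e f
  have hne : ((n : ℝ) - m) ≠ 0 := sub_ne_zero.mpr (Nat.cast_injective.ne hmn.symm)
  have hne' : ((n : ℂ) - m) ≠ 0 := sub_ne_zero.mpr (Nat.cast_injective.ne hmn.symm)
  -- At this time the two phases differ by `exp(iπ) = -1`, which forces the inner product to vanish.
  have h1 := inner_apply_of_mem_eigenSubmodule e.2 (Real.pi / (n - m)) (f : H)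
  rw [f.2, inner_smul_right] at h1
  have h2 : Complex.exp (Complex.I * n * ((Real.pi / (n - m) : ℝ) : ℂ))
      = -Complex.exp (Complex.I * m * ((Real.pi / (n - m) : ℝ) : ℂ)) := by
    rw [← neg_one_mul, ← Complex.exp_pi_mul_I, ← Complex.exp_add]
    congr 1
    push_cast
    field_simp
    ring
  rw [h2, neg_mul, neg_eq_iff_add_eq_zero, ← two_mul] at h1
  simpa [Complex.exp_ne_zero] using h1

/-- Both sides come from differentiating `⟨e, U t ψ⟩ = exp(int) ⟨e, ψ⟩` at 0. Only `ψ` has to be in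
the domain of the generator, so no self-adjointness is needed. -/
theorem inner_stoneGenerator_of_mem_eigenSubmodule {U : ℝ → (H ≃ₗᵢ[ℂ] H)} {n : ℕ} {e : H}
    (he : e ∈ eigenSubmodule U n) (ψ : (stoneGenerator U).domain) :
    inner ℂ e (stoneGenerator U ψ) = n * inner ℂ e (ψ : H) := by
  have hd : HasDerivAt (fun t => U t (ψ : H)) (deriv (fun t => U t (ψ : H)) 0) 0 :=
    DifferentiableAt.hasDerivAt ψ.2
  have h1 : HasDerivAt (fun t : ℝ => inner ℂ e (U t (ψ : H)))
      (inner ℂ e (deriv (fun t => U t (ψ : H)) 0)) 0 := by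
    simpa using (hasDerivAt_const (0 : ℝ) e).inner ℂ hd
  have h2 : HasDerivAt (fun t : ℝ => Complex.exp (Complex.I * n * t) * inner ℂ e (ψ : H))
      (Complex.I * n * inner ℂ e (ψ : H)) 0 := by
    have h3 : HasDerivAt (fun t : ℝ => Complex.I * n * (t : ℂ)) (Complex.I * n) 0 := by
      simpa using (Complex.ofRealCLM.hasDerivAt (x := (0 : ℝ))).const_mul (Complex.I * n)
    simpa using h3.cexp.mul_const (inner ℂ e (ψ : H))
  have h4 := h1.unique (h2.congr_of_eventuallyEq (Filter.Eventually.of_forall fun t =>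
    inner_apply_of_mem_eigenSubmodule he t _))
  change inner ℂ e (-Complex.I • deriv (fun t => U t (ψ : H)) 0) = _
  rw [inner_smul_right, h4]
  linear_combination (-(n : ℂ) * inner ℂ e (ψ : H)) * Complex.I_mul_I

/-- In the Hilbert sum of the eigenspaces the generator multiplies the component `ψ_n` by `n`, so
the inner product equals `∑ n ‖ψ_n‖²`. -/
theorem inner_stoneGenerator_nonneg [CompleteSpace H] {U : ℝ → (H ≃ₗᵢ[ℂ] H)}
    (hU : ⊤ ≤ (⨆ n, eigenSubmodule U n).topologicalClosure) (ψ : (stoneGenerator U).domain) :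
    0 ≤ inner ℂ (ψ : H) (stoneGenerator U ψ) := by
  have (n : ℕ) : CompleteSpace (eigenSubmodule U n) :=
    (isClosed_eigenSubmodule U n).completeSpace_coe
  have hV := IsHilbertSum.mkInternal _ (orthogonalFamily_eigenSubmodule U) hU
  have hcoord : ∀ (n : ℕ) (e : eigenSubmodule U n) (η : H),
      inner ℂ e (hV.linearIsometryEquiv η n) = inner ℂ (e : H) η := by
    intro n e η
    refine (lp.inner_single_left (𝕜 := ℂ) (G := fun i => eigenSubmodule U i) n e _).symm.trans ?_
    rw [← hV.linearIsometryEquiv.symm.inner_map_map,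
      LinearIsometryEquiv.symm_apply_apply, hV.linearIsometryEquiv_symm_apply_single]
    rfl
  have hgen : ∀ n, hV.linearIsometryEquiv (stoneGenerator U ψ) n
      = (n : ℂ) • hV.linearIsometryEquiv (ψ : H) n := fun n =>
    ext_inner_left ℂ fun e => by
      rw [hcoord, inner_smul_right, hcoord, inner_stoneGenerator_of_mem_eigenSubmodule e.2]
  rw [← hV.linearIsometryEquiv.inner_map_map]
  refine (lp.hasSum_inner _ _).nonneg fun n => ?_
  rw [hgen, inner_smul_right, inner_self_eq_norm_sq_to_K]
  exact mul_nonneg (Nat.cast_nonneg n) (by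
    rw [← RCLike.ofReal_pow]; exact Complex.zero_le_real.mpr (by positivity))

end Generator

/-! ### The GNS representation -/

section GNS

variable {A : Type*} [CStarAlgebra A] [PartialOrder A] [StarOrderedRing A] (ω : A →ₚ[ℂ] ℂ)

/-- The map `a ↦ π_ω(a) Ω`. -/
def gnsMap : A →L[ℂ] ω.GNS where
  toFun a := (ω.toPreGNS a : ω.PreGNS)
  map_add' a b := by rw [map_add, UniformSpace.Completion.coe_add]
  map_smul' c a := by rw [map_smul, UniformSpace.Completion.coe_smul]; rfl
  cont := by
    have h : ∀ a, ((ω.toPreGNS a : ω.PreGNS) : ω.GNS) = ω.gnsStarAlgHom a (gnsVector ω) := by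
      intro a
      simp [gnsVector]
    simp only [h]
    exact (ContinuousLinearMap.apply ℂ ω.GNS (gnsVector ω)).continuous.comp
      (map_continuous ω.gnsStarAlgHom)

theorem gnsMap_apply (a : A) : gnsMap ω a = (ω.toPreGNS a : ω.PreGNS) := rfl

theorem gnsMap_one : gnsMap ω 1 = gnsVector ω := rfl

theorem inner_gnsMap (a b : A) : inner ℂ (gnsMap ω a) (gnsMap ω b) = ω (star a * b) := by
  rw [gnsMap_apply, gnsMap_apply, UniformSpace.Completion.inner_coe]
  rfl

theorem gnsStarAlgHom_gnsMap (a b : A) : ω.gnsStarAlgHom a (gnsMap ω b) = gnsMap ω (a * b) := by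
  simp [gnsMap_apply]

theorem denseRange_gnsMap : DenseRange (gnsMap ω) :=
  (UniformSpace.Completion.denseRange_coe (α := ω.PreGNS)).comp
    ω.toPreGNS.surjective.denseRange (UniformSpace.Completion.continuous_coe _)

variable {ω}

/-- The vector of `b - 1` has squared norm `ω((b - 1)²) = 2 - 2 ω(b) = 0`, so `b` fixes the cyclic
vector. -/
theorem gnsMap_mul_eq {b : A} (hω : IsState ω) (hb : IsSelfAdjoint b) (hb2 : b * b = 1)
    (h : ω b = 1) (a : A) : gnsMap ω (a * b) = gnsMap ω a := by
  have h1 : gnsMap ω (b - 1) = 0 := by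
    rw [← inner_self_eq_zero (𝕜 := ℂ), inner_gnsMap, star_sub, star_one, hb.star_eq, sub_mul,
      mul_sub, hb2, mul_one, one_mul, map_sub, map_sub, map_sub, h, hω]
    simp
  have h2 := gnsStarAlgHom_gnsMap ω a (b - 1)
  rw [h1, map_zero, mul_sub, mul_one, map_sub] at h2
  exact (sub_eq_zero.mp h2.symm)

theorem apply_mul_eq {b : A} (hω : IsState ω) (hb : IsSelfAdjoint b) (hb2 : b * b = 1)
    (h : ω b = 1) (a : A) : ω (a * b) = ω a := by
  have := inner_gnsMap ω 1 (a * b)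
  rw [gnsMap_mul_eq hω hb hb2 h, inner_gnsMap, star_one, one_mul, one_mul] at this
  exact this.symm

theorem apply_mul_eq' {b : A} (hω : IsState ω) (hb : IsSelfAdjoint b) (hb2 : b * b = 1)
    (h : ω b = 1) (a : A) : ω (b * a) = ω a := by
  have h1 := inner_gnsMap ω b a
  have h2 := gnsMap_mul_eq hω hb hb2 h 1
  rw [one_mul] at h2
  rw [h2, inner_gnsMap, star_one, one_mul, hb.star_eq] at h1
  exact h1.symm

variable (ω) in
/-- The isometry of the GNS space that is induced by a state-preserving automorphism. -/
def gnsIsometry (φ : A ≃⋆ₐ[ℂ] A) (hφ : ∀ a, ω (φ a) = ω a) : ω.PreGNS →ₗᵢ[ℂ] ω.PreGNS where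
  toFun a := ω.toPreGNS (φ (ω.ofPreGNS a))
  map_add' a b := by simp
  map_smul' c a := by simp
  norm_map' a := by
    change ‖ω.toPreGNS (φ (ω.ofPreGNS a))‖ = ‖a‖
    rw [ω.preGNS_norm_def, ω.preGNS_norm_def, ω.ofPreGNS_toPreGNS, ← map_star, ← map_mul, hφ]

variable (ω) in
/-- The unitary of the GNS space that is induced by a state-preserving automorphism. -/
def gnsUnitary (φ : A ≃⋆ₐ[ℂ] A) (hφ : ∀ a, ω (φ a) = ω a) : ω.GNS ≃ₗᵢ[ℂ] ω.GNS :=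
  have hφ' : ∀ a, ω (φ.symm a) = ω a := fun a => by rw [← hφ, StarAlgEquiv.apply_symm_apply]
  let T := (gnsIsometry ω φ hφ).toContinuousLinearMap.completion
  let S := (gnsIsometry ω φ.symm hφ').toContinuousLinearMap.completion
  have hT : ∀ a, T (gnsMap ω a) = gnsMap ω (φ a) := fun a =>
    ContinuousLinearMap.completion_apply_coe _ _
  have hS : ∀ a, S (gnsMap ω a) = gnsMap ω (φ.symm a) := fun a =>
    ContinuousLinearMap.completion_apply_coe _ _
  { toFun := T
    invFun := S
    map_add' := map_add T
    map_smul' := map_smul T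
    left_inv := congrFun ((denseRange_gnsMap ω).equalizer (S.continuous.comp T.continuous)
      continuous_id (funext fun a => by simp [hT, hS]))
    right_inv := congrFun ((denseRange_gnsMap ω).equalizer (T.continuous.comp S.continuous)
      continuous_id (funext fun a => by simp [hT, hS]))
    norm_map' := congrFun ((denseRange_gnsMap ω).equalizer (T.continuous.norm)
      continuous_norm (funext fun a => by
        change ‖T (gnsMap ω a)‖ = ‖gnsMap ω a‖
        rw [hT, ← sq_eq_sq₀ (norm_nonneg _) (norm_nonneg _), ← Complex.ofReal_inj]
        have h1 := inner_self_eq_norm_sq_to_K (𝕜 := ℂ) (gnsMap ω (φ a))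
        have h2 := inner_self_eq_norm_sq_to_K (𝕜 := ℂ) (gnsMap ω a)
        rw [inner_gnsMap, ← map_star, ← map_mul, hφ, ← inner_gnsMap, h2] at h1
        push_cast
        exact h1.symm)) }

theorem gnsUnitary_gnsMap (φ : A ≃⋆ₐ[ℂ] A) (hφ : ∀ a, ω (φ a) = ω a) (a : A) :
    gnsUnitary ω φ hφ (gnsMap ω a) = gnsMap ω (φ a) :=
  ContinuousLinearMap.completion_apply_coe _ _

theorem implementsInGNS_gnsUnitary {α : ℝ → (A ≃⋆ₐ[ℂ] A)} (hα : ∀ s t a, α (s + t) a = α s (α t a))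
    (hc : ∀ a, Continuous fun t => α t a) (hω : ∀ t a, ω (α t a) = ω a) :
    ImplementsInGNS α ω fun t => gnsUnitary ω (α t) (hω t) where
  map_add s t := congrFun ((denseRange_gnsMap ω).equalizer (LinearIsometryEquiv.continuous _)
    ((LinearIsometryEquiv.continuous _).comp (LinearIsometryEquiv.continuous _))
    (funext fun a => by simp [gnsUnitary_gnsMap, hα]))
  continuous ψ := by
    -- Orbits of the dense vectors `gnsMap ω a` are continuous, and unitarity makes the
    -- approximation of the orbit of `ψ` uniform in `t`.
    refine continuous_of_uniform_approx_of_continuous fun u hu => ?_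
    obtain ⟨ε, hε, hu⟩ := Metric.mem_uniformity_dist.mp hu
    obtain ⟨a, ha⟩ := (denseRange_gnsMap ω).exists_dist_lt ψ hε
    refine ⟨fun t => gnsMap ω (α t a), (gnsMap ω).continuous.comp (hc a), fun t => hu ?_⟩
    change dist (gnsUnitary ω (α t) (hω t) ψ) (gnsMap ω (α t a)) < ε
    rw [← gnsUnitary_gnsMap (α t) (hω t), LinearIsometryEquiv.dist_map]
    exact ha
  covariant t a := congrFun ((denseRange_gnsMap ω).equalizer
    ((LinearIsometryEquiv.continuous _).comp (ContinuousLinearMap.continuous _))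
    ((ContinuousLinearMap.continuous _).comp (LinearIsometryEquiv.continuous _))
    (funext fun b => by
      simp [gnsUnitary_gnsMap, gnsStarAlgHom_gnsMap, -PositiveLinearMap.gnsStarAlgHom_apply]))
  vacuum t := by rw [← gnsMap_one, gnsUnitary_gnsMap, map_one]

/-- The element `k` is the energy change caused by `a`, and it acts as the number `n` next to the
cyclic vector. Since `k` is invariant under the evolution, the vector of `evol h t a` solves `f' = i
n f`; the proof shows that `exp(-int) f` is constant. -/
theorem gnsMap_evol {h a k : A} {n : ℂ} (hk : h * a - a * h = a * k) (hc : Commute h k)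
    (hn : ∀ b, gnsMap ω (b * k) = n • gnsMap ω b) (t : ℝ) :
    gnsMap ω (evol h t a) = Complex.exp (Complex.I * n * t) • gnsMap ω a := by
  have hev (t : ℝ) : h * evol h t a - evol h t a * h = evol h t a * k := by
    have h1 : evol h t h = h := evol_of_commute (Commute.refl h) t
    have h2 : evol h t k = k := evol_of_commute hc t
    have h3 : evol h t (h * a - a * h) = h * evol h t a - evol h t a * h := by
      rw [evol_sub, evol_mul, evol_mul, h1]
    rw [← h3, hk, evol_mul, h2]
  have hd (t : ℝ) : HasDerivAt (fun t : ℝ => Complex.exp (-(Complex.I * n * t)) •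
      gnsMap ω (evol h t a)) 0 t := by
    have h1 : HasDerivAt (fun t : ℝ => gnsMap ω (evol h t a))
        (gnsMap ω (Complex.I • (evol h t a * k))) t := by
      have := ((gnsMap ω).restrictScalars ℝ).hasFDerivAt.comp_hasDerivAt t (hasDerivAt_evol h t a)
      rwa [hev] at this
    rw [map_smul, hn, smul_smul] at h1
    have h3 : HasDerivAt (fun t : ℝ => -(Complex.I * n * (t : ℂ))) (-(Complex.I * n)) t := by
      simpa using ((Complex.ofRealCLM.hasDerivAt (x := t)).const_mul (-(Complex.I * n)))
    refine (h3.cexp.smul h1).congr_deriv ?_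
    rw [smul_smul, ← add_smul]
    convert zero_smul ℂ _ using 2
    ring
  have h1 := is_const_of_deriv_eq_zero (fun t => (hd t).differentiableAt)
    (fun t => (hd t).deriv) t 0
  simp only [Complex.ofReal_zero, mul_zero, neg_zero, Complex.exp_zero, one_smul, evol_zero] at h1
  rw [← h1, smul_smul, ← Complex.exp_add, add_neg_cancel, Complex.exp_zero, one_smul]

theorem apply_evol {h : A} (hh : ∀ b, ω (h * b) = ω (b * h)) (t : ℝ) (a : A) :
    ω (evol h t a) = ω a := by
  have hd (t : ℝ) : HasDerivAt (fun t : ℝ => ω (evol h t a)) 0 t := by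
    have := ((⟨ω.toLinearMap, map_continuous ω⟩ : A →L[ℂ] ℂ).restrictScalars
      ℝ).hasFDerivAt.comp_hasDerivAt t (hasDerivAt_evol h t a)
    refine this.congr_deriv ?_
    change ω (Complex.I • (h * evol h t a - evol h t a * h)) = 0
    rw [map_smul, map_sub, hh, sub_self, smul_zero]
  have h1 := is_const_of_deriv_eq_zero (fun t => (hd t).differentiableAt)
    (fun t => (hd t).deriv) t 0
  simpa [evol_zero] using h1

end GNS

/-! ### Stabilized states -/

theorem starOp_isSelfAdjoint (v : ℤ × ℤ) : IsSelfAdjoint (starOp v) :=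
  pauliMonomial_isSelfAdjoint _ _

theorem plaquetteOp_isSelfAdjoint (p : ℤ × ℤ) : IsSelfAdjoint (plaquetteOp p) :=
  pauliMonomial_isSelfAdjoint _ _

theorem starOp_mul_self (v : ℤ × ℤ) : starOp v * starOp v = 1 := by
  rw [starOp_eq, word_mul_self, sgn_empty_right, one_smul]

theorem plaquetteOp_mul_self (p : ℤ × ℤ) : plaquetteOp p * plaquetteOp p = 1 := by
  rw [plaquetteOp_eq, word_mul_self, sgn_empty_left, one_smul]

section Stabilized

variable {ω : ToricAlgebra →ₚ[ℂ] ℂ}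

theorem apply_toricInteraction_mul (h1 : IsState ω) (h2 : IsStabilized ω) (Y : Finset Edge)
    (b : ToricAlgebra) :
    ω (toricInteraction.toFun Y * b) = ω (b * toricInteraction.toFun Y) := by
  rcases toricInteraction_cases Y with ⟨v, rfl, h⟩ | ⟨p, rfl, h⟩ | h
  · rw [h, ← starOp_eq, neg_mul, mul_neg, map_neg, map_neg,
      apply_mul_eq h1 (starOp_isSelfAdjoint v) (starOp_mul_self v) (h2.1 v),
      apply_mul_eq' h1 (starOp_isSelfAdjoint v) (starOp_mul_self v) (h2.1 v)]
  · rw [h, ← plaquetteOp_eq, neg_mul, mul_neg, map_neg, map_neg,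
      apply_mul_eq h1 (plaquetteOp_isSelfAdjoint p) (plaquetteOp_mul_self p) (h2.2 p),
      apply_mul_eq' h1 (plaquetteOp_isSelfAdjoint p) (plaquetteOp_mul_self p) (h2.2 p)]
  · rw [h, zero_mul, mul_zero]

/-- Stars and plaquettes can be dropped from either side inside `ω`, so `ω` vanishes on commutators
with the local Hamiltonians. It is thus invariant under the local evolutions and under their limit.
-/
theorem apply_toricDynamics (h1 : IsState ω) (h2 : IsStabilized ω) (t : ℝ) (a : ToricAlgebra) :
    ω (toricDynamics t a) = ω a := by
  have h3 := ((map_continuous ω).tendsto _).comp (isDynamics_toricDynamics.tendsto t a)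
  refine tendsto_nhds_unique h3 (tendsto_const_nhds.congr fun Λ => ?_)
  refine (apply_evol (fun b => ?_) t a).symm
  rw [Interaction.hamiltonian, Finset.sum_mul, Finset.mul_sum, map_sum, map_sum]
  exact Finset.sum_congr rfl fun Y _ => apply_toricInteraction_mul h1 h2 Y b

theorem exists_commutator_eq_of_sgn {w b : ToricAlgebra} {s : ℂ} (hs : s = 1 ∨ s = -1)
    (h1 : IsState ω) (hb : IsSelfAdjoint b) (hb2 : b * b = 1) (h : ω b = 1)
    (hw : b * w = s • (w * b)) : ∃ (k : ℂ) (n : ℕ), -b * w - w * -b = w * (k • -b) ∧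
      ∀ x, gnsMap ω (x * (k • -b)) = (n : ℂ) • gnsMap ω x := by
  rcases hs with rfl | rfl
  · exact ⟨0, 0, by rw [neg_mul, hw]; simp, by simp⟩
  -- For anticommuting `b` and `w`, the commutator of `-b` with `w` is `2 w b`, and `b` acts as 1 on
  -- the cyclic vector: one violated term costs energy 2.
  · refine ⟨-2, 2, ?_, fun x => ?_⟩
    · rw [neg_mul, hw]
      simp only [mul_neg, neg_smul, one_smul, neg_neg, mul_add, smul_neg, two_smul,
        sub_neg_eq_add]
    · rw [mul_smul_comm, mul_neg, map_smul, map_neg, gnsMap_mul_eq h1 hb hb2 h]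
      simp

theorem exists_commutator_toricInteraction_word (h1 : IsState ω) (h2 : IsStabilized ω)
    (X Z Y : Finset Edge) : ∃ (k : ℂ) (n : ℕ),
      toricInteraction.toFun Y * word X Z - word X Z * toricInteraction.toFun Y
        = word X Z * (k • toricInteraction.toFun Y) ∧
      ∀ x, gnsMap ω (x * (k • toricInteraction.toFun Y)) = (n : ℂ) • gnsMap ω x := by
  rcases toricInteraction_cases Y with ⟨v, rfl, h⟩ | ⟨p, rfl, h⟩ | h
  · rw [h, ← starOp_eq]
    refine exists_commutator_eq_of_sgn (sgn_eq_or (starAt v) Z) h1 (starOp_isSelfAdjoint v)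
      (starOp_mul_self v) (h2.1 v) ?_
    rw [starOp_eq, word_commute_sgn, sgn_empty_left, mul_one]
  · rw [h, ← plaquetteOp_eq]
    refine exists_commutator_eq_of_sgn (sgn_eq_or (plaquetteAt p) X) h1
      (plaquetteOp_isSelfAdjoint p) (plaquetteOp_mul_self p) (h2.2 p) ?_
    rw [plaquetteOp_eq, word_commute_sgn, sgn_empty_left, one_mul]
  · exact ⟨0, 0, by simp [h], by simp⟩

theorem exists_gnsMap_toricDynamics_word (h1 : IsState ω) (h2 : IsStabilized ω)
    (X Z : Finset Edge) : ∃ n : ℕ, ∀ t, gnsMap ω (toricDynamics t (word X Z))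
      = Complex.exp (Complex.I * n * t) • gnsMap ω (word X Z) := by
  choose k n hk hn using exists_commutator_toricInteraction_word h1 h2 X Z
  refine ⟨∑ Y ∈ (collar (X ∪ Z)).powerset, n Y, fun t => ?_⟩
  rw [toricDynamics_word]
  refine gnsMap_evol (k := ∑ Y ∈ (collar (X ∪ Z)).powerset, k Y • toricInteraction.toFun Y)
    ?_ ?_ (fun b => ?_) t
  · rw [Interaction.hamiltonian, Finset.sum_mul, Finset.mul_sum, Finset.mul_sum,
      ← Finset.sum_sub_distrib]
    exact Finset.sum_congr rfl fun Y _ => hk Y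
  · exact Commute.sum_left _ _ _ fun Y _ => Commute.sum_right _ _ _ fun Y' _ =>
      (toricInteraction_commute Y Y').smul_right _
  · rw [Finset.mul_sum, map_sum, Nat.cast_sum, Finset.sum_smul]
    exact Finset.sum_congr rfl fun Y _ => hn Y b

theorem isGroundState_toricDynamics (h1 : IsState ω) (h2 : IsStabilized ω) :
    IsGroundState toricDynamics ω := by
  refine ⟨h1, apply_toricDynamics h1 h2, fun t => gnsUnitary ω (toricDynamics t)
    (apply_toricDynamics h1 h2 t), implementsInGNS_gnsUnitary isDynamics_toricDynamics.map_add
    isDynamics_toricDynamics.continuous _, fun ψ => inner_stoneGenerator_nonneg ?_ ψ⟩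
  set S := ⨆ n, eigenSubmodule (fun t => gnsUnitary ω (toricDynamics t)
    (apply_toricDynamics h1 h2 t)) n with hS
  have hword : ∀ a ∈ wordSpan Edge, gnsMap ω a ∈ S := fun a ha => by
    refine wordSpan_induction (p := fun a => gnsMap ω a ∈ S) (fun X Z => ?_) ?_ ?_ ?_ ha
    · obtain ⟨n, hn⟩ := exists_gnsMap_toricDynamics_word h1 h2 X Z
      exact Submodule.mem_iSup_of_mem n fun t => by rw [gnsUnitary_gnsMap, hn]
    · rw [map_zero]
      exact zero_mem _
    · intro a b ha hb
      rw [map_add]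
      exact add_mem ha hb
    · intro c a ha
      rw [map_smul]
      exact Submodule.smul_mem _ _ ha
  -- Words are eigenvectors and their span is dense, so the eigenspaces span a dense subspace of the
  -- GNS space.
  have hd : Dense (gnsMap ω '' (wordSpan Edge : Set ToricAlgebra)) :=
    (denseRange_gnsMap ω).dense_image (gnsMap ω).continuous dense_wordSpan
  intro ψ _
  exact closure_mono (Set.image_subset_iff.mpr hword) (hd ψ)

/-! ### The values of a stabilized state -/

theorem apply_mul_of_mem_stabilizerProducts (h1 : IsState ω) (h2 : IsStabilized ω)
    {a : ToricAlgebra} (ha : a ∈ stabilizerProducts) (x : ToricAlgebra) : ω (x * a) = ω x := by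
  induction ha using Submonoid.closure_induction generalizing x with
  | mem a ha =>
    rcases ha with ⟨v, rfl⟩ | ⟨p, rfl⟩
    · exact apply_mul_eq h1 (starOp_isSelfAdjoint v) (starOp_mul_self v) (h2.1 v) x
    · exact apply_mul_eq h1 (plaquetteOp_isSelfAdjoint p) (plaquetteOp_mul_self p) (h2.2 p) x
  | one => rw [mul_one]
  | mul a b _ _ ha hb => rw [← mul_assoc, hb, ha]

theorem apply_of_mem_stabilizerProducts (h1 : IsState ω) (h2 : IsStabilized ω)
    {a : ToricAlgebra} (ha : a ∈ stabilizerProducts) : ω a = 1 := by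
  have := apply_mul_of_mem_stabilizerProducts h1 h2 ha 1
  rwa [one_mul, h1] at this

/-- Here `ω(w) = ω(b w) = -ω(w b) = -ω(w)`. -/
theorem apply_eq_zero_of_anticommute {w b : ToricAlgebra} (h1 : IsState ω) (hb : IsSelfAdjoint b)
    (hb2 : b * b = 1) (h : ω b = 1) (hw : b * w = -(w * b)) : ω w = 0 := by
  have := apply_mul_eq' h1 hb hb2 h w
  rw [hw, map_neg, apply_mul_eq h1 hb hb2 h] at this
  exact self_eq_neg.mp this.symm

theorem apply_word_eq_zero (h1 : IsState ω) (h2 : IsStabilized ω) {X Z : Finset Edge}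
    (h : word X Z ∉ stabilizerProducts) : ω (word X Z) = 0 := by
  by_cases hX : ∀ p, sgn (plaquetteAt p) X = 1
  · by_cases hZ : ∀ v, sgn (starAt v) Z = 1
    · exact absurd (word_mem_stabilizerProducts X Z hX hZ) h
    · push Not at hZ
      obtain ⟨v, hv⟩ := hZ
      refine apply_eq_zero_of_anticommute h1 (starOp_isSelfAdjoint v) (starOp_mul_self v)
        (h2.1 v) ?_
      rw [starOp_eq, word_commute_sgn, sgn_empty_left, (sgn_eq_or _ _).resolve_left hv, mul_one,
        neg_smul, one_smul]
  · push Not at hX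
    obtain ⟨p, hp⟩ := hX
    refine apply_eq_zero_of_anticommute h1 (plaquetteOp_isSelfAdjoint p) (plaquetteOp_mul_self p)
      (h2.2 p) ?_
    rw [plaquetteOp_eq, word_commute_sgn, sgn_empty_left, (sgn_eq_or _ _).resolve_left hp, one_mul,
      neg_smul, one_smul]

theorem apply_pauliMonomial_eq_zero (h1 : IsState ω) (h2 : IsStabilized ω) (Λ : Finset Edge)
    (k : Edge → Fin 3) (h : pauliMonomial Λ k ∉ stabilizerProducts)
    (h' : -pauliMonomial Λ k ∉ stabilizerProducts) : ω (pauliMonomial Λ k) = 0 := by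
  obtain ⟨c, X, Z, hc, hP⟩ := exists_pauliMonomial_eq Λ k
  by_cases hw : word X Z ∈ stabilizerProducts
  · exfalso
    -- If the word is a stabilizer product, the phase `c` is the expectation of a self-adjoint
    -- element. It is then real of modulus 1, so the monomial or its negative is a stabilizer
    -- product.
    have h3 : ω (pauliMonomial Λ k) = c := by
      rw [hP, map_smul, apply_of_mem_stabilizerProducts h1 h2 hw, smul_eq_mul, mul_one]
    have h4 : (starRingEnd ℂ) c = c := by
      rw [← h3, ← Complex.star_def, ← map_star, (pauliMonomial_isSelfAdjoint Λ k).star_eq]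
    have h5 : c * c = 1 := by
      have := Complex.mul_conj' c
      rwa [h4, hc, Complex.ofReal_one, one_pow] at this
    rcases mul_self_eq_one_iff.mp h5 with rfl | rfl
    · exact h (by rwa [hP, one_smul])
    · exact h' (by rwa [hP, neg_smul, one_smul, neg_neg])
  · rw [hP, map_smul, apply_word_eq_zero h1 h2 hw, smul_zero]

theorem eq_of_isStabilized {ω' : ToricAlgebra →ₚ[ℂ] ℂ} (h1 : IsState ω) (h2 : IsStabilized ω)
    (h1' : IsState ω') (h2' : IsStabilized ω') : ω = ω' := by
  have hspan : Set.EqOn ω ω' (wordSpan Edge) := fun a ha => by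
    refine wordSpan_induction (p := fun a => ω a = ω' a) (fun X Z => ?_) ?_ ?_ ?_ ha
    · by_cases hw : word X Z ∈ stabilizerProducts
      · rw [apply_of_mem_stabilizerProducts h1 h2 hw, apply_of_mem_stabilizerProducts h1' h2' hw]
      · rw [apply_word_eq_zero h1 h2 hw, apply_word_eq_zero h1' h2' hw]
    · rw [map_zero, map_zero]
    · intro a b ha hb
      rw [map_add, map_add, ha, hb]
    · intro c a ha
      rw [map_smul, map_smul, ha]
  exact PositiveLinearMap.ext fun a => congrFun (Continuous.ext_on dense_wordSpan
    (map_continuous ω) (map_continuous ω') hspan) a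

end Stabilized

/-! ### Existence of states with prescribed values of the stars and plaquettes -/

theorem toOp_word {Γ : Type*} [DecidableEq Γ] (X Z : Finset Γ) : toOp (word X Z) = wordOp X Z := rfl

theorem toOp_mul_apply {Γ : Type*} [DecidableEq Γ] (a b : QuasiLocal Γ) (ψ : SpinSpace Γ) :
    toOp (a * b) ψ = toOp a (toOp b ψ) := by
  rw [map_mul]; rfl

theorem norm_toOp_le {Γ : Type*} [DecidableEq Γ] (a : QuasiLocal Γ) : ‖toOp a‖ ≤ ‖a‖ := le_rfl

theorem toOp_apply_of_mul_eq_smul {Γ : Type*} [DecidableEq Γ] {a w : QuasiLocal Γ} {s : ℂ}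
    (h : a * w = s • (w * a)) {φ : SpinSpace Γ} (hφ : toOp a φ = φ) :
    toOp a (toOp w φ) = s • toOp w φ := by
  rw [← toOp_mul_apply, h, map_smul]
  change s • toOp (w * a) φ = _
  rw [toOp_mul_apply, hφ]

theorem starOp_commute (v w : ℤ × ℤ) : Commute (starOp v) (starOp w) := by
  rw [starOp_eq, starOp_eq]
  exact word_commute (by simp)

theorem plaquetteOp_commute (p q : ℤ × ℤ) : Commute (plaquetteOp p) (plaquetteOp q) := by
  rw [plaquetteOp_eq, plaquetteOp_eq]
  exact word_commute (by simp)

theorem starOp_commute_plaquetteOp (v p : ℤ × ℤ) : Commute (starOp v) (plaquetteOp p) := by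
  rw [starOp_eq, plaquetteOp_eq]
  exact word_commute (by simp [sgn_starAt_plaquetteAt])

theorem exists_vector_allUp (F : Finset (ℤ × ℤ)) : ∃ φ : SpinSpace Edge, φ ≠ 0 ∧
    (∀ v ∈ F, toOp (starOp v) φ = φ) ∧ ∀ p, toOp (plaquetteOp p) φ = φ := by
  -- Nonnegative coefficients are carried along so that adding `toOp (starOp v) φ` cannot cancel the
  -- component at `∅`.
  suffices h : ∃ φ : SpinSpace Edge, (∀ s, 0 ≤ φ s) ∧ 0 < φ ∅ ∧
      (∀ v ∈ F, toOp (starOp v) φ = φ) ∧ ∀ p, toOp (plaquetteOp p) φ = φ by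
    obtain ⟨φ, _, h0, h⟩ := h
    refine ⟨φ, ?_, h⟩
    rintro rfl
    exact lt_irrefl _ h0
  induction F using Finset.induction_on with
  | empty =>
    -- The vector with all spins up is fixed by every plaquette. Each induction step applies `1 +
    -- A_v`, which projects onto the fixed vectors of `A_v` up to a factor 2.
    refine ⟨lp.single 2 ∅ 1, fun s => ?_, by simp, by simp, fun p => ?_⟩
    · by_cases hs : s = ∅
      · subst hs; simp
      · simp [hs]
    · ext s
      rw [plaquetteOp_eq, toOp_word, wordOp_apply, ← Finset.bot_eq_empty, symmDiff_bot]
      by_cases hs : s = ∅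
      · subst hs; simp
      · simp [hs]
  | insert v F hv ih =>
    obtain ⟨φ, hpos, h0, hF, hp⟩ := ih
    have hA : ∀ s, 0 ≤ toOp (starOp v) φ s := fun s => by
      rw [starOp_eq, toOp_word, wordOp_apply, sgn_empty_left, one_mul]
      exact hpos _
    refine ⟨φ + toOp (starOp v) φ, fun s => add_nonneg (hpos s) (hA s),
      add_pos_of_pos_of_nonneg h0 (hA ∅), fun w hw => ?_, fun p => ?_⟩
    · rcases Finset.mem_insert.mp hw with rfl | hw
      · rw [map_add, ← toOp_mul_apply, starOp_mul_self, map_one, add_comm]; rfl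
      · rw [map_add, ← toOp_mul_apply, (starOp_commute w v).eq, toOp_mul_apply, hF w hw]
    · rw [map_add, ← toOp_mul_apply, ← (starOp_commute_plaquetteOp v p).eq, toOp_mul_apply, hp]

theorem sgn_filter {α : Type*} [DecidableEq α] (F : Finset α) (f : α → ℤˣ) {v : α} (hv : v ∈ F) :
    sgn {v} (F.filter fun w => f w = -1) = ((f v : ℤ) : ℂ) := by
  rw [sgn_singleton_left]
  rcases Int.units_eq_one_or (f v) with h | h <;> simp [h, hv]

/-- Strings ending at the sites where `c` is `-1` anticommute with exactly the corresponding stars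
and plaquettes in `F`, so they turn the all-up vector into one with the prescribed signs. -/
theorem exists_vector (c : IsingConfig) (F : Finset (ℤ × ℤ)) : ∃ ψ : SpinSpace Edge, ‖ψ‖ = 1 ∧
    (∀ v ∈ F, toOp (starOp v) ψ = ((c.1 v : ℤ) : ℂ) • ψ) ∧
    ∀ p ∈ F, toOp (plaquetteOp p) ψ = ((c.2 p : ℤ) : ℂ) • ψ := by
  obtain ⟨φ, h0, hF, hp⟩ := exists_vector_allUp F
  obtain ⟨Z, hZ⟩ := exists_star_flips F (F.filter fun w => c.1 w = -1)
  obtain ⟨X, hX⟩ := exists_plaquette_flips F (F.filter fun w => c.2 w = -1)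
  have hne : toOp (word X Z) φ ≠ 0 := by
    intro h
    have h3 := toOp_mul_apply (word X Z) (word X Z) φ
    rw [h, map_zero, word_mul_self, map_smul, map_one] at h3
    exact h0 ((smul_eq_zero.mp h3).resolve_left (sgn_ne_zero _ _))
  refine ⟨((‖toOp (word X Z) φ‖⁻¹ : ℝ) : ℂ) • toOp (word X Z) φ, ?_, fun v hv => ?_,
    fun p hp' => ?_⟩
  · rw [norm_smul]
    simp [norm_ne_zero_iff.mpr hne]
  · have h : starOp v * word X Z = ((c.1 v : ℤ) : ℂ) • (word X Z * starOp v) := by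
      rw [starOp_eq, word_commute_sgn, sgn_empty_left, mul_one, hZ v hv, sgn_filter F c.1 hv]
    rw [map_smul, toOp_apply_of_mul_eq_smul h (hF v hv), smul_comm]
  · have h : plaquetteOp p * word X Z = ((c.2 p : ℤ) : ℂ) • (word X Z * plaquetteOp p) := by
      rw [plaquetteOp_eq, word_commute_sgn, sgn_empty_left, one_mul, hX p hp',
        sgn_filter F c.2 hp']
    rw [map_smul, toOp_apply_of_mul_eq_smul h (hp p), smul_comm]

open Filter Topology in
/-- A weak-* limit point of the vector states of a net of unit vectors. -/
theorem exists_limit_state {Γ ι : Type*} [DecidableEq Γ] (l : Filter ι) [l.NeBot]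
    (ψ : ι → SpinSpace Γ) (hψ : ∀ i, ‖ψ i‖ = 1) : ∃ ω : QuasiLocal Γ →ₚ[ℂ] ℂ, IsState ω ∧
      ∀ a z, (∀ᶠ i in l, toOp a (ψ i) = z • ψ i) → ω a = z := by
  have hself : ∀ i, inner ℂ (ψ i) (ψ i) = (1 : ℂ) := fun i => by
    rw [inner_self_eq_norm_sq_to_K, hψ]; simp
  -- A single ultrafilter makes the bounded expectation values of all observables converge together,
  -- so the limit is linear.
  have hlim : ∀ a : QuasiLocal Γ, ∃ z : ℂ,
      Tendsto (fun i => inner ℂ (ψ i) (toOp a (ψ i))) (Ultrafilter.of l : Filter ι) (𝓝 z) := by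
    intro a
    have hb : ∀ i, inner ℂ (ψ i) (toOp a (ψ i)) ∈ Metric.closedBall (0 : ℂ) ‖a‖ := fun i => by
      rw [mem_closedBall_zero_iff]
      calc ‖inner ℂ (ψ i) (toOp a (ψ i))‖ ≤ ‖ψ i‖ * ‖toOp a (ψ i)‖ := norm_inner_le_norm _ _
        _ ≤ 1 * (‖toOp a‖ * ‖ψ i‖) := by
          rw [hψ]
          gcongr
          exact ((toOp a).le_opNorm _).trans (by rw [hψ])
        _ ≤ ‖a‖ := by rw [hψ, one_mul, mul_one]; exact norm_toOp_le a
    obtain ⟨z, _, hz⟩ := (isCompact_closedBall (0 : ℂ) ‖a‖).ultrafilter_le_nhds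
      ((Ultrafilter.of l).map fun i => inner ℂ (ψ i) (toOp a (ψ i)))
      (le_principal_iff.mpr (Filter.mem_map.mpr (Filter.univ_mem' hb)))
    exact ⟨z, hz⟩
  choose f hf using hlim
  let g : QuasiLocal Γ →ₗ[ℂ] ℂ :=
    { toFun := f
      map_add' := fun a b => tendsto_nhds_unique (hf (a + b)) (((hf a).add (hf b)).congr fun i => by
        rw [map_add, ← inner_add_right]; rfl)
      map_smul' := fun c a => tendsto_nhds_unique (hf (c • a))
        (((hf a).const_mul c).congr fun i => by
          rw [map_smul, ← inner_smul_right]; rfl) }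
  have hval : ∀ a z, (∀ᶠ i in l, toOp a (ψ i) = z • ψ i) → f a = z := fun a z h =>
    tendsto_nhds_unique (hf a) (tendsto_const_nhds.congr'
      ((h.filter_mono (Ultrafilter.of_le l)).mono
      fun i hi => by
        change z = inner ℂ (ψ i) (toOp a (ψ i))
        rw [hi, inner_smul_right, hself, mul_one]))
  refine ⟨PositiveLinearMap.mk₀ g fun a ha => ?_, ?_, hval⟩
  · obtain ⟨b, rfl⟩ := CStarAlgebra.nonneg_iff_eq_star_mul_self.mp ha
    refine ge_of_tendsto' (hf _) fun i => ?_
    rw [toOp_mul_apply, map_star, ContinuousLinearMap.star_eq_adjoint,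
      ContinuousLinearMap.adjoint_inner_right, inner_self_eq_norm_sq_to_K, ← RCLike.ofReal_pow]
    exact Complex.zero_le_real.mpr (by positivity)
  · exact hval 1 1 (Filter.Eventually.of_forall fun i => by rw [map_one, one_smul]; rfl)

open Filter in
theorem exists_state (c : IsingConfig) : ∃ ω : ToricAlgebra →ₚ[ℂ] ℂ, IsState ω ∧
    (∀ v, ω (starOp v) = ((c.1 v : ℤ) : ℂ)) ∧ ∀ p, ω (plaquetteOp p) = ((c.2 p : ℤ) : ℂ) := by
  choose ψ h1 h2 h3 using exists_vector c
  obtain ⟨ω, hω, h⟩ := exists_limit_state atTop ψ h1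
  refine ⟨ω, hω, fun v => h _ _ ?_, fun p => h _ _ ?_⟩
  · exact (eventually_ge_atTop {v}).mono fun F hF => h2 F v (Finset.singleton_subset_iff.mp hF)
  · exact (eventually_ge_atTop {p}).mono fun F hF => h3 F p (Finset.singleton_subset_iff.mp hF)

/-! ### The classical Ising picture -/

section MultiplicativeDomain

variable {A : Type*} [CStarAlgebra A] [PartialOrder A] [StarOrderedRing A] {ω : A →ₚ[ℂ] ℂ}

/-- The multiplicative domain of a scalar-valued state. -/
def multiplicativeDomain (hω : IsState ω) : StarSubalgebra ℂ A where
  carrier := {a | ∀ b, ω (a * b) = ω a * ω b ∧ ω (b * a) = ω b * ω a}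
  mul_mem' {a b} ha hb c := by
    rw [mul_assoc, (ha _).1, (hb _).1, (ha _).1, ← mul_assoc c, (hb _).2, (ha _).2]
    exact ⟨(mul_assoc _ _ _).symm, mul_assoc _ _ _⟩
  add_mem' {a b} ha hb c := by
    rw [add_mul, mul_add, map_add, map_add, map_add, (ha _).1, (hb _).1, (ha _).2, (hb _).2]
    exact ⟨(add_mul _ _ _).symm, (mul_add _ _ _).symm⟩
  algebraMap_mem' c b := by
    have hω : ω 1 = 1 := hω
    rw [Algebra.algebraMap_eq_smul_one, smul_one_mul, mul_smul_one, map_smul, map_smul, hω,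
      smul_eq_mul, smul_eq_mul, mul_one]
    exact ⟨rfl, mul_comm _ _⟩
  star_mem' {a} ha b := by
    have h1 := (ha (star b)).1
    have h2 := (ha (star b)).2
    refine ⟨?_, ?_⟩
    · rw [← star_inj, ← map_star, star_mul, star_star, h2, map_star, map_star, star_mul',
        star_star, mul_comm]
    · rw [← star_inj, ← map_star, star_mul, star_star, h1, map_star, map_star, star_mul',
        star_star, mul_comm]

theorem isClosed_multiplicativeDomain (hω : IsState ω) :
    IsClosed (multiplicativeDomain hω : Set A) := by
  have hc := map_continuous ω
  have : (multiplicativeDomain hω : Set A)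
      = ⋂ b, {a | ω (a * b) = ω a * ω b} ∩ {a | ω (b * a) = ω b * ω a} := by
    ext a
    simp [multiplicativeDomain]
  rw [this]
  exact isClosed_iInter fun b => (isClosed_eq (by fun_prop) (by fun_prop)).inter
    (isClosed_eq (by fun_prop) (by fun_prop))

/-- The cyclic vector is an eigenvector of `b` with eigenvalue `±1`. The negative sign is reduced to
the positive one by passing to `-b`. -/
theorem mem_multiplicativeDomain {b : A} (hω : IsState ω) (hb : IsSelfAdjoint b) (hb2 : b * b = 1)
    {u : ℤˣ} (h : ω b = ((u : ℤ) : ℂ)) : b ∈ multiplicativeDomain hω := by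
  intro a
  rcases Int.units_eq_one_or u with rfl | rfl
  · have h : ω b = 1 := by simpa using h
    rw [apply_mul_eq hω hb hb2 h, apply_mul_eq' hω hb hb2 h, h, one_mul, mul_one]
    exact ⟨rfl, rfl⟩
  · have h' : ω b = -1 := by simpa using h
    have hn : ω (-b) = 1 := by rw [map_neg, h', neg_neg]
    have h1 := apply_mul_eq hω hb.neg (by rwa [neg_mul_neg]) hn a
    have h2 := apply_mul_eq' hω hb.neg (by rwa [neg_mul_neg]) hn a
    rw [mul_neg, map_neg] at h1
    rw [neg_mul, map_neg] at h2
    rw [h', neg_one_mul, mul_neg_one]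
    exact ⟨neg_eq_iff_eq_neg.mp h2, neg_eq_iff_eq_neg.mp h1⟩

end MultiplicativeDomain

theorem classicalAlgebra_le {S : StarSubalgebra ℂ ToricAlgebra}
    (hc : IsClosed (S : Set ToricAlgebra)) (hA : ∀ v, starOp v ∈ S) (hB : ∀ p, plaquetteOp p ∈ S) :
    classicalAlgebra ≤ S := by
  refine StarSubalgebra.topologicalClosure_minimal (StarAlgebra.adjoin_le ?_) hc
  rintro _ (⟨v, rfl⟩ | ⟨p, rfl⟩)
  · exact hA v
  · exact hB p

/-- The generators commute, so the closed algebra they generate lies in their centralizer and also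
in their double centralizer. -/
theorem classicalAlgebra_mul_comm (a b : classicalAlgebra) : a * b = b * a := by
  set s : Set ToricAlgebra := Set.range starOp ∪ Set.range plaquetteOp with hs
  have h1 : classicalAlgebra ≤ StarSubalgebra.centralizer ℂ s := by
    refine classicalAlgebra_le (Set.isClosed_centralizer _) (fun v => ?_) fun p => ?_
    · rw [StarSubalgebra.mem_centralizer_iff]
      rintro _ (⟨w, rfl⟩ | ⟨q, rfl⟩)
      · rw [(starOp_isSelfAdjoint w).star_eq]
        exact ⟨starOp_commute w v, starOp_commute w v⟩
      · rw [(plaquetteOp_isSelfAdjoint q).star_eq]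
        exact ⟨(starOp_commute_plaquetteOp v q).symm, (starOp_commute_plaquetteOp v q).symm⟩
    · rw [StarSubalgebra.mem_centralizer_iff]
      rintro _ (⟨w, rfl⟩ | ⟨q, rfl⟩)
      · rw [(starOp_isSelfAdjoint w).star_eq]
        exact ⟨starOp_commute_plaquetteOp w p, starOp_commute_plaquetteOp w p⟩
      · rw [(plaquetteOp_isSelfAdjoint q).star_eq]
        exact ⟨plaquetteOp_commute q p, plaquetteOp_commute q p⟩
  have h2 := StarSubalgebra.topologicalClosure_adjoin_le_centralizer_centralizer ℂ s a.2
  rw [StarSubalgebra.mem_centralizer_iff] at h2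
  exact Subtype.ext (h2 b (h1 b.2)).1.symm

/-! ### Gelfand duality for the classical algebra. -/

section Gelfand

local instance : IsClosed (classicalAlgebra : Set ToricAlgebra) :=
  StarSubalgebra.isClosed_topologicalClosure _

local instance : CommCStarAlgebra classicalAlgebra where
  __ := (inferInstance : CStarAlgebra classicalAlgebra)
  mul_comm := classicalAlgebra_mul_comm

open WeakDual

/-- The star operator as an element of the classical algebra. -/
def clStar (v : ℤ × ℤ) : classicalAlgebra := ⟨starOp v, starOp_mem v⟩

/-- The plaquette operator as an element of the classical algebra. -/
def clPlaquette (p : ℤ × ℤ) : classicalAlgebra := ⟨plaquetteOp p, plaquetteOp_mem p⟩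

theorem exists_unit_of_mul_self (χ : characterSpace ℂ classicalAlgebra) {a : classicalAlgebra}
    (ha : a * a = 1) : ∃ u : ℤˣ, ((u : ℤ) : ℂ) = χ a := by
  have h : χ a * χ a = 1 := by rw [← map_mul, ha, map_one]
  rcases mul_self_eq_one_iff.mp h with h | h
  · exact ⟨1, by simp [h]⟩
  · exact ⟨-1, by simp [h]⟩

theorem exists_config (χ : characterSpace ℂ classicalAlgebra) : ∃ c : IsingConfig,
    (∀ v, ((c.1 v : ℤ) : ℂ) = χ (clStar v)) ∧ ∀ p, ((c.2 p : ℤ) : ℂ) = χ (clPlaquette p) := by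
  choose f hf using fun v => exists_unit_of_mul_self χ (a := clStar v)
    (Subtype.ext (starOp_mul_self v))
  choose g hg using fun p => exists_unit_of_mul_self χ (a := clPlaquette p)
    (Subtype.ext (plaquetteOp_mul_self p))
  exact ⟨(f, g), hf, hg⟩

/-- The values of a character at the stars and plaquettes. -/
def characterConfig (χ : characterSpace ℂ classicalAlgebra) : IsingConfig :=
  (exists_config χ).choose

theorem characterConfig_fst (χ : characterSpace ℂ classicalAlgebra) (v : ℤ × ℤ) :
    (((characterConfig χ).1 v : ℤ) : ℂ) = χ (clStar v) := (exists_config χ).choose_spec.1 v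

theorem characterConfig_snd (χ : characterSpace ℂ classicalAlgebra) (p : ℤ × ℤ) :
    (((characterConfig χ).2 p : ℤ) : ℂ) = χ (clPlaquette p) := (exists_config χ).choose_spec.2 p

theorem continuous_characterConfig : Continuous characterConfig := by
  have hemb : Topology.IsClosedEmbedding fun u : ℤˣ => ((u : ℤ) : ℂ) :=
    Continuous.isClosedEmbedding continuous_of_discreteTopology
      (Int.cast_injective.comp Units.val_injective)
  have heval : ∀ a : classicalAlgebra,
      Continuous fun χ : characterSpace ℂ classicalAlgebra => χ a :=
    fun a => (WeakDual.eval_continuous a).comp continuous_subtype_val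
  refine (continuous_pi fun v => ?_).prodMk (continuous_pi fun p => ?_)
  · rw [hemb.continuous_iff]
    exact (heval (clStar v)).congr fun χ => (characterConfig_fst χ v).symm
  · rw [hemb.continuous_iff]
    exact (heval (clPlaquette p)).congr fun χ => (characterConfig_snd χ p).symm

/-- The set where two characters agree is a closed `*`-subalgebra, so agreement on the generators
suffices. -/
theorem characterSpace_ext {χ χ' : characterSpace ℂ classicalAlgebra}
    (h1 : ∀ v, χ (clStar v) = χ' (clStar v)) (h2 : ∀ p, χ (clPlaquette p) = χ' (clPlaquette p)) :
    χ = χ' := by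
  have hle : classicalAlgebra ≤ (StarAlgHom.equalizer χ χ').map classicalAlgebra.subtype := by
    refine classicalAlgebra_le ?_ (fun v => ⟨clStar v, h1 v, rfl⟩)
      fun p => ⟨clPlaquette p, h2 p, rfl⟩
    have hcl : IsClosed (classicalAlgebra : Set ToricAlgebra) := inferInstance
    exact hcl.isClosedEmbedding_subtypeVal.isClosedMap _
      (isClosed_eq (map_continuous χ) (map_continuous χ'))
  refine DFunLike.ext _ _ fun a => ?_
  obtain ⟨b, hb, hba⟩ := hle a.2
  rw [← Subtype.ext hba]
  exact hb

theorem injective_characterConfig : Function.Injective characterConfig := fun χ χ' h =>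
  characterSpace_ext (fun v => by rw [← characterConfig_fst, h, characterConfig_fst])
    fun p => by rw [← characterConfig_snd, h, characterConfig_snd]

/-- A state with values `±1` at the stars and plaquettes restricts to a character. -/
theorem exists_character {ω : ToricAlgebra →ₚ[ℂ] ℂ} (hω : IsState ω) (c : IsingConfig)
    (h1 : ∀ v, ω (starOp v) = ((c.1 v : ℤ) : ℂ)) (h2 : ∀ p, ω (plaquetteOp p) = ((c.2 p : ℤ) : ℂ)) :
    ∃ χ : characterSpace ℂ classicalAlgebra, characterConfig χ = c ∧
      ∀ a : classicalAlgebra, χ a = ω (a : ToricAlgebra) := by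
  have hM : classicalAlgebra ≤ multiplicativeDomain hω :=
    classicalAlgebra_le (isClosed_multiplicativeDomain hω)
      (fun v => mem_multiplicativeDomain hω (starOp_isSelfAdjoint v) (starOp_mul_self v) (h1 v))
      fun p => mem_multiplicativeDomain hω (plaquetteOp_isSelfAdjoint p)
        (plaquetteOp_mul_self p) (h2 p)
  let φ : classicalAlgebra →ₐ[ℂ] ℂ := AlgHom.ofLinearMap
    (ω.toLinearMap.comp classicalAlgebra.subtype.toAlgHom.toLinearMap) hω
    fun a b => (hM a.2 b).1
  refine ⟨CharacterSpace.equivAlgHom.symm φ, ?_, fun a => rfl⟩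
  have hinj : Function.Injective fun u : ℤˣ => ((u : ℤ) : ℂ) :=
    Int.cast_injective.comp Units.val_injective
  refine Prod.ext (funext fun v => hinj ?_) (funext fun p => hinj ?_)
  · exact (characterConfig_fst _ v).trans (h1 v)
  · exact (characterConfig_snd _ p).trans (h2 p)

/-- This expresses that there are no relations among stars and plaquettes on the infinite plane:
every sign pattern comes from a state of the full algebra. -/
theorem surjective_characterConfig : Function.Surjective characterConfig := fun c => by
  obtain ⟨ω, hω, h1, h2⟩ := exists_state c
  obtain ⟨χ, hχ, _⟩ := exists_character hω c h1 h2
  exact ⟨χ, hχ⟩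

/-- The character space of the classical algebra is the configuration space of two Ising
systems. -/
def characterHomeo : characterSpace ℂ classicalAlgebra ≃ₜ IsingConfig :=
  continuous_characterConfig.homeoOfEquivCompactToT2
    (f := Equiv.ofBijective characterConfig ⟨injective_characterConfig, surjective_characterConfig⟩)

/-- The identification of the classical algebra with the continuous functions on the
configuration space. -/
def isingEquiv : classicalAlgebra ≃⋆ₐ[ℂ] C(IsingConfig, ℂ) :=
  (gelfandStarTransform classicalAlgebra).trans (characterHomeo.symm.compStarAlgEquiv' ℂ ℂ)

theorem isingEquiv_apply (a : classicalAlgebra) (χ : characterSpace ℂ classicalAlgebra) :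
    isingEquiv a (characterConfig χ) = χ a := by
  change characterHomeo.symm (characterHomeo χ) a = χ a
  rw [Homeomorph.symm_apply_apply]

theorem isingEquiv_starOp (v : ℤ × ℤ) : isingEquiv ⟨starOp v, starOp_mem v⟩ = isingStar v := by
  ext c
  obtain ⟨χ, rfl⟩ := surjective_characterConfig c
  rw [isingEquiv_apply]
  exact (characterConfig_fst χ v).symm

theorem isingEquiv_plaquetteOp (p : ℤ × ℤ) :
    isingEquiv ⟨plaquetteOp p, plaquetteOp_mem p⟩ = isingPlaquette p := by
  ext c
  obtain ⟨χ, rfl⟩ := surjective_characterConfig c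
  rw [isingEquiv_apply]
  exact (characterConfig_snd χ p).symm

/-- Prescribing `ω` only on the generators already determines it on the classical algebra, because a
state with values `±1` there is multiplicative. Parts (3) and (4) thereby become the same uniqueness
statement. -/
theorem isStabilized_iff {ω : ToricAlgebra →ₚ[ℂ] ℂ} (hω : IsState ω) :
    IsStabilized ω ↔ ∀ a : classicalAlgebra, ω (a : ToricAlgebra) = isingEquiv a allUp := by
  constructor
  · intro h a
    obtain ⟨χ, hχ, h'⟩ := exists_character hω allUp (fun v => by simp [h.1 v, allUp])
      fun p => by simp [h.2 p, allUp]
    rw [← h', ← hχ, isingEquiv_apply]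
  · intro h
    refine ⟨fun v => ?_, fun p => ?_⟩
    · rw [h ⟨starOp v, starOp_mem v⟩, isingEquiv_starOp]
      simp [isingStar, allUp]
    · rw [h ⟨plaquetteOp p, plaquetteOp_mem p⟩, isingEquiv_plaquetteOp]
      simp [isingPlaquette, allUp]

theorem existsUnique_isStabilized :
    ∃! ω : ToricAlgebra →ₚ[ℂ] ℂ, IsState ω ∧ IsStabilized ω := by
  obtain ⟨ω, hω, h1, h2⟩ := exists_state allUp
  have hs : IsStabilized ω := ⟨fun v => by simp [h1, allUp], fun p => by simp [h2, allUp]⟩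
  exact ⟨ω, ⟨hω, hs⟩, fun ω' h => eq_of_isStabilized h.1 h.2 hω hs⟩

end Gelfand

end ToricCode

end

/-! ### The main theorem. -/

open ToricCode in
theorem mainTheorem9 :
    (∃! α : ℝ → (ToricAlgebra ≃⋆ₐ[ℂ] ToricAlgebra), toricInteraction.IsDynamics α) ∧
    (∀ α : ℝ → (ToricAlgebra ≃⋆ₐ[ℂ] ToricAlgebra), toricInteraction.IsDynamics α →
      ∀ ω : ToricAlgebra →ₚ[ℂ] ℂ, IsState ω → IsStabilized ω → IsGroundState α ω) ∧
    (∃ Θ : classicalAlgebra ≃⋆ₐ[ℂ] C(IsingConfig, ℂ),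
      (∀ v, Θ ⟨starOp v, starOp_mem v⟩ = isingStar v) ∧
      (∀ p, Θ ⟨plaquetteOp p, plaquetteOp_mem p⟩ = isingPlaquette p) ∧
      ∃! ω : ToricAlgebra →ₚ[ℂ] ℂ, IsState ω ∧
        ∀ a : classicalAlgebra, ω (a : ToricAlgebra) = Θ a allUp) ∧
    (∃! ω : ToricAlgebra →ₚ[ℂ] ℂ, IsState ω ∧ IsStabilized ω) ∧
    (∀ ω : ToricAlgebra →ₚ[ℂ] ℂ, IsState ω → IsStabilized ω →
      (∀ a ∈ stabilizerProducts, ω a = 1) ∧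
      ∀ (Λ : Finset Edge) (k : Edge → Fin 3),
        pauliMonomial Λ k ∉ stabilizerProducts → -pauliMonomial Λ k ∉ stabilizerProducts →
          ω (pauliMonomial Λ k) = 0) := by
  refine ⟨⟨toricDynamics, isDynamics_toricDynamics, fun α hα =>
      isDynamics_unique hα isDynamics_toricDynamics⟩, fun α hα ω h1 h2 => ?_,
    ⟨isingEquiv, isingEquiv_starOp, isingEquiv_plaquetteOp, ?_⟩, existsUnique_isStabilized,
    fun ω h1 h2 => ⟨fun a ha => apply_of_mem_stabilizerProducts h1 h2 ha,
      apply_pauliMonomial_eq_zero h1 h2⟩⟩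
  · rw [isDynamics_unique hα isDynamics_toricDynamics]
    exact isGroundState_toricDynamics h1 h2
  · obtain ⟨ω, ⟨h1, h2⟩, hu⟩ := existsUnique_isStabilized
    exact ⟨ω, ⟨h1, (isStabilized_iff h1).mp h2⟩, fun ω' h =>
      hu ω' ⟨h.1, (isStabilized_iff h.1).mpr h.2⟩⟩
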